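/- Let $\mathfrak g=\mathfrak{sl}(2,\mathbb R)$, with basis $H=\begin{pmatrix}1&0\\0&-1\end{pmatrix}$, $X=\begin{pmatrix}0&1\\0&0\end{pmatrix}$, $Y=\begin{pmatrix}0&0\\1&0\end{pmatrix}$ and generic element $\begin{pmatrix}h&x\\y&-h\end{pmatrix}$. Let $\mathcal N$ be the cone of nilpotent matrices in $\mathfrak g$ and $\mathcal N^+=\{Z\in\mathcal N : x-y>0\}$. For an open set $\mathcal U\subset\mathfrak g$ and a finite dimensional real representation $(\rho,E)$ of $\mathfrak g$, let $\mathcal C^{-\infty}(\mathcal U,E)$ be the space of $E$-valued generalized functions (distributions) on $\mathcal U$. Such a $\phi$ is called locally invariant if $\rho(Z)\phi+\mathcal L_Z\phi=0$ for all $Z\in\mathfrak g$, where $(\mathcal L_Z\phi)(P)=\frac{d}{dt}\phi(P-t[Z,P])|_{t=0}$. Let $\square=\frac12\partial_H^2+2\partial_Y\partial_X$. Let $n\in\mathbb N$, let $V_n$ be the irreducible representation of $\mathfrak g$ of dimension $n+1$, and let $W$ be a finite dimensional real vector space with trivial action of $\mathfrak g$. Let $\mathcal U$ be an open connected neighborhood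 of $X$ in $\mathfrak g$. (1) Let $\phi\in\mathcal C^{-\infty}(\mathcal U,W\otimes V_n)$ be locally invariant with $\phi|_{\mathcal U\setminus\mathcal N}=0$. Let $r\in\mathbb N$ and $a_0,\dots,a_{r-1}\in\mathbb R$ be such that $\bigl(\square^r+\sum_{k=0}^{r-1}a_k\square^k\bigr)\phi=0$. If $n$ is even, or if $n$ is odd, $r\ge 1$ and $a_0\ne0$, then $\phi=0$. (2) By contrast, let $n$ be odd. Let $\mu_1:\mathbb R^2\to\mathfrak g$, $\mu_1(a,b)=\frac12\begin{pmatrix}-ab&a^2\\-b^2&ab\end{pmatrix}$, which restricts to a two-fold covering $\mathbb R^2\setminus\{0\}\to\mathcal N^+$, and suppose that there is a continuous section $s_1:\mathcal U\cap\mathcal N^+\to\mathbb R^2$, $\mu_1(s_1(Z))=Z$. Let $v\in V_n\setminus\{0\}$ with $\rho(X)v=0$, and put $s_n(Z)=\sum_{j=0}^n\frac{a^{n-j}b^j}{j!}\rho(Y)^jv$ for $Z\in\mathcal U\cap\mathcal N^+$ and $(a,b)=s_1(Z)$. Let $s_n\delta_{\mathcal N^+}\in\mathcal C^{-\infty}(\mathcal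 U,V_n)$ be given by $$\int_{\mathcal U}(s_n\delta_{\mathcal N^+})(Z)f(Z)\,dZ=2\int_{\mathbb R^2}f(\mu_1(p))\,s_n(\mu_1(p))\,dp\qquad(f\in C_c^\infty(\mathcal U)).$$ This generalized function is well defined. For $0\le i\le\frac{n-1}2$ the generalized function $\square^i(s_n\delta_{\mathcal N^+})$ is nonzero, locally invariant, zero on $\mathcal U\setminus\mathcal N$, and it satisfies $\square^k\bigl(\square^i(s_n\delta_{\mathcal N^+})\bigr)=0$ for all $k\ge\frac{n+1}2$. (3) Every neighborhood of $X$ contains an open connected neighborhood $\mathcal U$ of $X$ that admits a section $s_1$ as in (2). -/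

import Mathlib

open scoped Distributions LineDeriv TensorProduct
open MeasureTheory TopologicalSpace

noncomputable section

namespace SL2Dist

/-! ### The Lie algebra -/

/-- The Lie algebra `𝔤 = 𝔰𝔩(2, ℝ)` of traceless real `2 × 2` matrices. -/
def sl2 : Type := LieAlgebra.SpecialLinear.sl (Fin 2) ℝ

instance instLieRingSl2 : LieRing sl2 :=
  inferInstanceAs (LieRing (LieAlgebra.SpecialLinear.sl (Fin 2) ℝ))

instance instLieAlgebraSl2 : LieAlgebra ℝ sl2 :=
  inferInstanceAs (LieAlgebra ℝ (LieAlgebra.SpecialLinear.sl (Fin 2) ℝ))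

/-- The underlying matrix of an element of `𝔰𝔩(2, ℝ)`. -/
def mat : sl2 →ₗ[ℝ] Matrix (Fin 2) (Fin 2) ℝ where
  toFun Z := Z.1
  map_add' _ _ := rfl
  map_smul' _ _ := rfl

theorem mat_injective : Function.Injective mat := Subtype.val_injective

theorem trace_mat (Z : sl2) : (mat Z).trace = 0 := LinearMap.mem_ker.mp Z.2

theorem mat_lie (Z Z' : sl2) : mat ⁅Z, Z'⁆ = mat Z * mat Z' - mat Z' * mat Z := rfl

/-- The entries of an element of `𝔰𝔩(2, ℝ)`. -/
def entries : sl2 →ₗ[ℝ] (Fin 2 → Fin 2 → ℝ) where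
  toFun Z := fun i j => mat Z i j
  map_add' Z Z' := by ext i j; simp
  map_smul' c Z := by ext i j; simp

/-- The sup norm of the entries. It only serves to fix the topology and the smooth structure of
the finite dimensional real vector space `𝔰𝔩(2, ℝ)`. -/
instance instNormedAddCommGroupSl2 : NormedAddCommGroup sl2 :=
  NormedAddCommGroup.induced sl2 (Fin 2 → Fin 2 → ℝ) entries fun _ _ h => mat_injective h

instance instNormedSpaceSl2 : NormedSpace ℝ sl2 :=
  NormedSpace.induced ℝ sl2 (Fin 2 → Fin 2 → ℝ) entries

instance instFiniteDimensionalSl2 : FiniteDimensional ℝ sl2 :=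
  Module.Finite.of_injective mat mat_injective

/-- The element of `𝔰𝔩(2, ℝ)` with rows `(h, x)` and `(y, -h)`. -/
def ofCoords (h x y : ℝ) : sl2 :=
  ⟨!![h, x; y, -h], LinearMap.mem_ker.mpr (by simp [Matrix.trace_fin_two])⟩

theorem mat_ofCoords (h x y : ℝ) : mat (ofCoords h x y) = !![h, x; y, -h] := rfl

/-- `H` is the diagonal matrix with diagonal `(1, -1)`. -/
def H : sl2 := ofCoords 1 0 0

/-- `X` is the matrix with rows `(0, 1)` and `(0, 0)`. -/
def X : sl2 := ofCoords 0 1 0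

/-- `Y` is the matrix with rows `(0, 0)` and `(1, 0)`. -/
def Y : sl2 := ofCoords 0 0 1

/-- The cone `𝒩` of nilpotent matrices in `𝔰𝔩(2, ℝ)`. -/
def nilCone : Set sl2 := {Z | IsNilpotent (mat Z)}

/-- The half cone `𝒩⁺`: the nilpotent matrices with rows `(h, x)`, `(y, -h)` and `x - y > 0`. -/
def nilConePos : Set sl2 := {Z | Z ∈ nilCone ∧ 0 < mat Z 0 1 - mat Z 1 0}

/-! ### Generalized functions

The generalized functions on an open set `U` with values in a topological vector space `E` are the
elements of `𝓓'(U, E)`: a test function `f` stands for the density `f dZ`, with `dZ` the Lebesgue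
measure `dh dx dy`. -/

section GeneralizedFunctions

variable {U : Opens sl2}

/-- The test function `(L_Z f)(P) = d/dt f(P - t [Z, P])` at `t = 0`. -/
def lieDerivTest (Z : sl2) (f : 𝓓(U, ℝ)) : 𝓓(U, ℝ) where
  toFun P := fderiv ℝ f P (-⁅Z, P⁆)
  contDiff' := by
    have hlin : ContDiff ℝ ((⊤ : ℕ∞) : WithTop ℕ∞) fun P : sl2 => -⁅Z, P⁆ :=
      (LinearMap.toContinuousLinearMap (-(LieAlgebra.ad ℝ sl2 Z))).contDiff
    exact (f.contDiff.fderiv_right le_rfl).clm_apply hlin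
  hasCompactSupport' := by
    refine (f.hasCompactSupport.fderiv (𝕜 := ℝ)).mono fun P hP => ?_
    rw [Function.mem_support] at hP ⊢
    intro h0
    exact hP (by rw [h0]; rfl)
  tsupport_subset' := by
    refine (closure_mono fun P hP => ?_).trans ((tsupport_fderiv_subset ℝ).trans f.tsupport_subset)
    rw [Function.mem_support] at hP ⊢
    intro h0
    exact hP (by rw [h0]; rfl)

variable {E : Type*} [AddCommGroup E] [Module ℝ E] [TopologicalSpace E]

/-- `φ` is locally invariant: `ρ(Z) φ + L_Z φ = 0` for all `Z ∈ 𝔤`. As the vector field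
`P ↦ -[Z, P]` has divergence `0`, the generalized function `L_Z φ` is `f ↦ -φ(L_Z f)`. -/
def IsLocallyInvariant [LieRingModule sl2 E] (φ : 𝓓'(U, E)) : Prop :=
  ∀ (Z : sl2) (f : 𝓓(U, ℝ)), ⁅Z, φ f⁆ + -(φ (lieDerivTest Z f)) = 0

/-- The restriction of `φ` to `U ∖ 𝒩` is zero. -/
def IsSupportedInNilCone (φ : 𝓓'(U, E)) : Prop :=
  ∀ f : 𝓓(U, ℝ), tsupport f ⊆ (U : Set sl2) \ nilCone → φ f = 0

/-- The Casimir operator `□ = ½ ∂_H² + 2 ∂_Y ∂_X` on generalized functions. -/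
def casimir [IsTopologicalAddGroup E] [ContinuousSMul ℝ E] (φ : 𝓓'(U, E)) : 𝓓'(U, E) :=
  (1 / 2 : ℝ) • ∂_{H} (∂_{H} φ) + (2 : ℝ) • ∂_{Y} (∂_{X} φ)

end GeneralizedFunctions

/-! ### The generalized function `s_n δ_{𝒩⁺}` -/

/-- The moment map `μ₁ : ℝ² → 𝔰𝔩(2, ℝ)`. -/
def moment (p : Fin 2 → ℝ) : sl2 :=
  ofCoords (-(p 0 * p 1) / 2) (p 0 ^ 2 / 2) (-(p 1 ^ 2) / 2)

/-- `moment p` is characterized by `tr (μ₁(p) Z) = ½ B(p, Z p)` for all `Z`, where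
`B(p, q) = p₀ q₁ - p₁ q₀`. -/
theorem eq_moment_iff (p : Fin 2 → ℝ) (M : sl2) :
    M = moment p ↔ ∀ Z : sl2, (mat M * mat Z).trace =
      (1 / 2) * (p 0 * (mat Z).mulVec p 1 - p 1 * (mat Z).mulVec p 0) := by
  have key : ∀ Z : sl2, (mat (moment p) * mat Z).trace =
      (1 / 2) * (p 0 * (mat Z).mulVec p 1 - p 1 * (mat Z).mulVec p 0) := by
    intro Z
    have h := trace_mat Z
    rw [Matrix.trace_fin_two] at h
    have h' : mat Z 1 1 = -mat Z 0 0 := by linarith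
    simp only [moment, mat_ofCoords, Matrix.trace_fin_two, Matrix.mul_apply, Fin.sum_univ_two,
      Matrix.mulVec, dotProduct, h']
    simp
    ring
  refine ⟨fun h => h ▸ key, fun h => mat_injective ?_⟩
  have hM := trace_mat M
  have hm := trace_mat (moment p)
  rw [Matrix.trace_fin_two] at hM hm
  have e := fun Z => (h Z).trans (key Z).symm
  have e1 := e (ofCoords 1 0 0)
  have e2 := e (ofCoords 0 1 0)
  have e3 := e (ofCoords 0 0 1)
  simp only [mat_ofCoords, Matrix.trace_fin_two, Matrix.mul_apply, Fin.sum_univ_two] at e1 e2 e3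
  simp at e1 e2 e3
  ext i j
  fin_cases i <;> fin_cases j <;> simp <;> linarith

/-- `s` is a continuous section over `U ∩ 𝒩⁺` of the two-fold covering `μ₁ : ℝ² ∖ {0} → 𝒩⁺`. -/
def IsSection (U : Opens sl2) (s : sl2 → Fin 2 → ℝ) : Prop :=
  ContinuousOn s ((U : Set sl2) ∩ nilConePos) ∧
    ∀ Z ∈ (U : Set sl2) ∩ nilConePos, moment (s Z) = Z

/-- The `𝔰𝔩(2, ℝ)`-equivariant homogeneous polynomial map `ℝ² → V` of degree `n` which sends
`(1, 0)` to the highest weight vector `v` of the irreducible representation `V` of dimension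
`n + 1`. If `V` is identified with the homogeneous polynomials of degree `n` in `e, f`
and `v` with `e ^ n`, this is `(a, b) ↦ (a e + b f) ^ n`. -/
def powerMap (n : ℕ) {V : Type*} [AddCommGroup V] [Module ℝ V] [LieRingModule sl2 V]
    [LieModule ℝ sl2 V] (v : V) (p : Fin 2 → ℝ) : V :=
  ∑ j ∈ Finset.range (n + 1),
    (p 0 ^ (n - j) * p 1 ^ j / (j.factorial : ℝ)) • ((LieModule.toEnd ℝ sl2 V Y) ^ j) v

/-- `φ` is the generalized function `s_n δ_{𝒩⁺}` on `U`, where `s_n(Z) = powerMap n v (s Z)` and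
`δ_{𝒩⁺}` is the image under `μ₁` of twice the Lebesgue measure of `ℝ²`. -/
def IsSectionDelta (n : ℕ) {V : Type*} [NormedAddCommGroup V] [NormedSpace ℝ V]
    [LieRingModule sl2 V] [LieModule ℝ sl2 V] (v : V) {U : Opens sl2} (s : sl2 → Fin 2 → ℝ)
    (φ : 𝓓'(U, V)) : Prop :=
  ∀ f : 𝓓(U, ℝ), φ f = (2 : ℝ) • ∫ p : Fin 2 → ℝ, f (moment p) • powerMap n v (s (moment p))

end SL2Dist

end

noncomputable section

namespace SL2Dist

/-! ### Identities in Weyl algebras -/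

section WeylOne

variable {A : Type*} [Ring A] [Algebra ℝ A]

/-! The proof reduces the Casimir equation to algebra in one variable transversal to the cone. A
generalized function is studied on the test functions supported in a compact `K ⊆ U`, as a linear
map `u`, and operators act by composition. Then `u ∘ a = 0` implies `u ∘ (a * b) = 0`, so the
operators killing `u` form a right ideal.

Support in the cone, together with finite order on `K`, gives `u ∘ q ^ N = 0` for `q = h² + xy`
(`exists_mulOp_pow_eq_zero`). Let `Λ` be the coefficient of the highest weight vector. By invariance
`Λ ∘ u` is killed by `L_Y` and by `L_H - n`, and it determines `u`, because `Λ (X ^ j e)` recovers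
all the coordinates of `e`. Where `x ≠ 0`, put `d = x⁻¹ ∂_Y`, so that `d q = q d + 1`; modulo the
right ideal generated by `L_Y` and `L_H - n` the Casimir operator is `2 d q d - (1 + n) d`
(`box_eq_radial`).

This radial operator sends `q ^ N` to `N (2N - 1 - n) q ^ (N - 1)` modulo `q ^ N` on the left. For
even `n` the coefficient is nonzero for every `N ≥ 1`, so a monic equation lowers `N` step by step
to `0` and `u = 0`. For odd `n` the descent stops at `N = (n + 1) / 2 = m`. There the `m`-th power
of the radial operator is a left multiple of `q ^ m`, so `□ ^ m` kills `u`, and `a₀ ≠ 0` forces `u =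
0`. What could remain lives on `x = 0`, hence on `h = 0`; that plane is noncharacteristic for `□`,
so the equation excludes it (`eq_zero_of_noncharacteristic`).

For the second statement, `s_n δ` is invariant because a traceless linear vector field on `ℝ²` has
divergence zero and both `μ₁` and `s_n` are equivariant. It is killed by `q` itself. The same
coefficients, nonzero below `m`, show that `□ ^ i (s_n δ) ≠ 0` for `i < m`, and the identity for the
`m`-th power gives `□ ^ m (s_n δ) = 0` where `x ≠ 0`. On the rest, nilpotency of `X` on the values
replaces the missing equation (`IsLocallyInvariant.eq_zero_of_entry_ne_zero`). This needs `0 ∉ U`,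
which holds because a section cannot exist on a loop around the origin. -/

theorem weyl_pow_comm {d q : A} (h : d * q = q * d + 1) (N : ℕ) :
    d * q ^ N = q ^ N * d + (N : ℝ) • q ^ (N - 1) := by
  induction N with
  | zero => simp
  | succ N ih =>
    -- At `N = 0` the truncated exponent `N - 1` is harmless, as its coefficient vanishes.
    have hN : (N : ℝ) • (q ^ (N - 1) * q) = (N : ℝ) • q ^ N := by
      rcases N with _ | N
      · simp
      · simp [pow_succ]
    rw [pow_succ, ← mul_assoc, ih, add_mul, mul_assoc, h, smul_mul_assoc, hN, mul_add, mul_one,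
      Nat.add_sub_cancel]
    push_cast
    simp only [mul_assoc]
    module

/-- The radial part of the Casimir operator, acting from the right on functionals. -/
def radial (n : ℝ) (q d : A) : A := (2 : ℝ) • (d * q * d) - (1 + n) • d

/-- The indicial polynomial `N (2N - 1 - n)` of the radial operator. Its only root `N ≥ 1` is `(n +
1) / 2`, and the dichotomy between even and odd `n` comes from there. -/
theorem radial_mul_pow {d q : A} (h : d * q = q * d + 1) (n : ℝ) (N : ℕ) :
    ∃ B, radial n q d * q ^ N = ((N : ℝ) * (2 * N - 1 - n)) • q ^ (N - 1) + q ^ N * B := by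
  have h1 := weyl_pow_comm h N
  have h2 := weyl_pow_comm h (N + 1)
  refine ⟨(2 : ℝ) • (q * d * d) + (4 * N + 1 - n) • d, ?_⟩
  have hN : (N : ℝ) • (q * q ^ (N - 1)) = (N : ℝ) • q ^ N := by
    rcases N with _ | N
    · simp
    · simp [pow_succ']
  have e1 : d * q * d * q ^ N = q ^ N * (q * d * d) + (2 * N + 1 : ℝ) • (q ^ N * d)
      + ((N : ℝ) * N) • q ^ (N - 1) := by
    rw [mul_assoc (d * q), h1, mul_add, mul_smul_comm]
    have : d * q * (q ^ N * d) = q ^ N * (q * d * d) + ((N : ℝ) + 1) • (q ^ N * d) := by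
      rw [mul_assoc d, ← mul_assoc q, ← pow_succ', ← mul_assoc, h2, add_mul]
      simp only [Nat.add_sub_cancel, smul_mul_assoc, pow_succ, mul_assoc]
      push_cast
      rfl
    rw [this, mul_assoc d, ← mul_smul_comm (N : ℝ) d, hN, mul_smul_comm, h1]
    module
  rw [radial, sub_mul, smul_mul_assoc, smul_mul_assoc, e1, h1, mul_add, mul_smul_comm,
    mul_smul_comm]
  module

/-- Each radial factor costs at most one power of `q`. This disposes of the lower order terms of a
monic equation. -/
theorem radial_pow_mul_pow_mem {d q : A} (h : d * q = q * d + 1) (n : ℝ) (k M : ℕ) :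
    ∃ B, radial n q d ^ k * q ^ (M + k) = q ^ M * B := by
  induction k generalizing M with
  | zero => exact ⟨1, by simp⟩
  | succ k ihk =>
    obtain ⟨C, hC⟩ := radial_mul_pow h n (M + (k + 1))
    obtain ⟨B, hB⟩ := ihk M
    obtain ⟨B', hB'⟩ := ihk (M + 1)
    refine ⟨(((M + (k + 1) : ℕ) : ℝ) * (2 * ((M + (k + 1) : ℕ) : ℝ) - 1 - n)) • B
      + q * B' * C, ?_⟩
    rw [pow_succ, mul_assoc, hC, show M + (k + 1) - 1 = M + k by omega, mul_add,
      mul_smul_comm, hB, ← mul_assoc, show M + (k + 1) = M + 1 + k by omega, hB', pow_succ]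
    simp only [mul_add, mul_smul_comm, mul_assoc]

/-- The leading coefficient is the product of the indicial values met while descending from `q ^ (N
- 1 + r)` to `q ^ (N - 1)`. -/
theorem radial_pow_mul_pow {d q : A} (h : d * q = q * d + 1) (n : ℝ) (N r : ℕ) (hN : 1 ≤ N) :
    ∃ B, radial n q d ^ r * q ^ (N - 1 + r) =
      (∏ j ∈ Finset.range r, ((N + j : ℝ) * (2 * (N + j) - 1 - n))) • q ^ (N - 1) + q ^ N * B := by
  induction r with
  | zero => exact ⟨0, by simp⟩
  | succ r ih =>
    obtain ⟨B, hB⟩ := ih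
    obtain ⟨C, hC⟩ := radial_mul_pow h n (N - 1 + (r + 1))
    obtain ⟨B', hB'⟩ := radial_pow_mul_pow_mem h n r N
    refine ⟨(((N + r : ℕ) : ℝ) * (2 * ((N + r : ℕ) : ℝ) - 1 - n)) • B + B' * C, ?_⟩
    rw [pow_succ, mul_assoc, hC, show N - 1 + (r + 1) - 1 = N - 1 + r by omega,
      show N - 1 + (r + 1) = N + r by omega, mul_add, mul_smul_comm, hB, ← mul_assoc, hB',
      Finset.prod_range_succ]
    push_cast
    simp only [mul_add, mul_smul_comm, mul_assoc, smul_add]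
    module

theorem weyl_pow_mul {d q : A} (h : d * q = q * d + 1) (k : ℕ) :
    d ^ k * (q * d) = (q * d + (k : ℝ) • 1) * d ^ k := by
  induction k with
  | zero => simp
  | succ k ih =>
    have : d * (q * d) = (q * d + 1) * d := by rw [← mul_assoc, h]
    rw [pow_succ', mul_assoc, ih, add_mul, mul_add, ← mul_assoc, this]
    push_cast
    simp only [smul_mul_assoc, mul_smul_comm, one_mul, add_mul, mul_assoc, ← pow_succ']
    module

-- `q d` is the Euler operator, and `q ^ k d ^ k` is its falling factorial.
open Polynomial in
theorem weyl_pow_mul_pow {d q : A} (h : d * q = q * d + 1) (k : ℕ) :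
    q ^ k * d ^ k = aeval (q * d) (∏ i ∈ Finset.range k, (Polynomial.X - C (i : ℝ) : ℝ[X])) := by
  have h' : ∀ k : ℕ, d ^ k * q = q * d ^ k + (k : ℝ) • d ^ (k - 1) := by
    intro k
    induction k with
    | zero => simp
    | succ k ih =>
      have hk : (k : ℝ) • (d * d ^ (k - 1)) = (k : ℝ) • d ^ k := by
        rcases k with _ | k
        · simp
        · simp [pow_succ']
      rw [pow_succ', mul_assoc, ih, mul_add, mul_smul_comm, hk, ← mul_assoc, h, add_mul, one_mul,
        mul_assoc, Nat.add_sub_cancel]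
      push_cast
      module
  induction k with
  | zero => simp
  | succ k ih =>
    have hk : (k : ℝ) • (d ^ (k - 1) * d) = (k : ℝ) • d ^ k := by
      rcases k with _ | k
      · simp
      · simp [pow_succ]
    have : d ^ k * (q * d) = q * d ^ (k + 1) + (k : ℝ) • d ^ k := by
      rw [← mul_assoc, h', add_mul, smul_mul_assoc, hk, pow_succ, mul_assoc]
    rw [Finset.prod_range_succ, map_mul, ← ih, map_sub, aeval_X, aeval_C, mul_sub, mul_assoc,
      this, Algebra.algebraMap_eq_smul_one, mul_smul_comm, mul_one, mul_add, mul_smul_comm,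
      pow_succ q, mul_assoc]
    module

open Polynomial in
/-- For `n = 2 m - 1` the `m`-th power of the radial part is `2 ^ m q ^ m d ^ (2 m)`. -/
theorem radial_pow_self {d q : A} (h : d * q = q * d + 1) (m : ℕ) :
    ∃ B, radial (2 * m - 1) q d ^ m = q ^ m * B := by
  have hr : radial (2 * m - 1 : ℝ) q d = (2 : ℝ) • ((q * d + (1 - m : ℝ) • 1) * d) := by
    rw [radial, h]
    simp only [add_mul, smul_mul_assoc, one_mul]
    module
  -- Moving each `d` to the right shifts the Euler operator by one. At `j = m` the roots `m - 1 - i`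
  -- run through `0, …, m - 1`, and the product becomes the falling factorial `q ^ m d ^ m`.
  have key : ∀ j : ℕ, radial (2 * m - 1 : ℝ) q d ^ j = (2 : ℝ) ^ j •
      (aeval (q * d) (∏ i ∈ Finset.range j, (Polynomial.X - C ((m : ℝ) - 1 - i) : ℝ[X])) * d ^ j) := by
    intro j
    induction j with
    | zero => simp
    | succ j ih =>
      have e : d ^ j * (q * d + (1 - m : ℝ) • 1) = (q * d - ((m : ℝ) - 1 - j) • 1) * d ^ j := by
        rw [mul_add, weyl_pow_mul h, mul_smul_comm, mul_one, add_mul, sub_mul, smul_mul_assoc,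
          smul_mul_assoc, one_mul]
        module
      rw [pow_succ, ih, Finset.prod_range_succ, hr, smul_mul_smul_comm, ← pow_succ, mul_assoc,
        ← mul_assoc (d ^ j), e, map_mul, map_sub, aeval_X, aeval_C,
        Algebra.algebraMap_eq_smul_one, pow_succ d]
      simp only [mul_assoc]
  refine ⟨(2 : ℝ) ^ m • (d ^ m * d ^ m), ?_⟩
  rw [key, mul_smul_comm, ← mul_assoc, weyl_pow_mul_pow h]
  congr 3
  rw [← Finset.prod_range_reflect]
  refine Finset.prod_congr rfl fun i hi => ?_
  rw [Finset.mem_range] at hi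
  congr 2
  rw [Nat.sub_sub, Nat.cast_sub (by omega)]
  push_cast
  ring

/-- Only `½ p²` lowers the power of `h` by two, and its coefficient `½ (K + 2) (K + 1)` never
vanishes: the plane `h = 0` is noncharacteristic. -/
theorem noncharacteristic_mul_pow {p h R : A} (hp : p * h = h * p + 1) (hR : R * h = h * R)
    (K : ℕ) : ∃ B, ((1 / 2 : ℝ) • (p * p) + R) * h ^ (K + 2) =
      ((1 / 2 : ℝ) * (K + 2) * (K + 1)) • h ^ K + h ^ (K + 1) * B := by
  have hR' : R * h ^ (K + 2) = h ^ (K + 2) * R := Commute.pow_right hR _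
  have h1 := weyl_pow_comm hp (K + 2)
  have h2 := weyl_pow_comm hp (K + 1)
  rw [show K + 2 - 1 = K + 1 from rfl] at h1
  rw [show K + 1 - 1 = K from rfl] at h2
  refine ⟨(1 / 2 : ℝ) • (h * p * p) + (K + 2 : ℝ) • p + h * R, ?_⟩
  rw [add_mul, smul_mul_assoc, mul_assoc, h1, mul_add, ← mul_assoc p, h1, mul_smul_comm, h2, hR',
    pow_succ h (K + 1)]
  push_cast
  simp only [mul_add, add_mul, mul_smul_comm, smul_mul_assoc, mul_assoc]
  module

theorem noncharacteristic_pow_mul_pow_mem {p h R : A} (hp : p * h = h * p + 1)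
    (hR : R * h = h * R) (k M : ℕ) :
    ∃ B, ((1 / 2 : ℝ) • (p * p) + R) ^ k * h ^ (M + 2 * k) = h ^ M * B := by
  induction k generalizing M with
  | zero => exact ⟨1, by simp⟩
  | succ k ih =>
    obtain ⟨C, hC⟩ := noncharacteristic_mul_pow hp hR (M + 2 * k)
    obtain ⟨B, hB⟩ := ih M
    obtain ⟨B', hB'⟩ := ih (M + 1)
    refine ⟨((1 / 2 : ℝ) * ((M + 2 * k : ℕ) + 2) * ((M + 2 * k : ℕ) + 1)) • B + h * B' * C, ?_⟩
    rw [pow_succ, mul_assoc, show M + 2 * (k + 1) = M + 2 * k + 2 by ring, hC, mul_add,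
      mul_smul_comm, hB, ← mul_assoc, show M + 2 * k + 1 = M + 1 + 2 * k by ring, hB', pow_succ]
    simp only [mul_add, mul_smul_comm, mul_assoc]

theorem noncharacteristic_pow_mul_pow {p h R : A} (hp : p * h = h * p + 1)
    (hR : R * h = h * R) (M r : ℕ) :
    ∃ c : ℝ, c ≠ 0 ∧ ∃ B, ((1 / 2 : ℝ) • (p * p) + R) ^ r * h ^ (M + 2 * r) =
      c • h ^ M + h ^ (M + 1) * B := by
  induction r with
  | zero => exact ⟨1, one_ne_zero, 0, by simp⟩
  | succ r ih =>
    obtain ⟨c, hc, B, hB⟩ := ih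
    obtain ⟨C, hC⟩ := noncharacteristic_mul_pow hp hR (M + 2 * r)
    obtain ⟨B', hB'⟩ := noncharacteristic_pow_mul_pow_mem hp hR r (M + 1)
    set e : ℝ := (1 / 2 : ℝ) * ((M + 2 * r : ℕ) + 2) * ((M + 2 * r : ℕ) + 1) with he
    refine ⟨e * c, mul_ne_zero (by positivity) hc, e • B + B' * C, ?_⟩
    rw [pow_succ, mul_assoc, show M + 2 * (r + 1) = M + 2 * r + 2 by ring, hC, mul_add,
      mul_smul_comm, hB, ← mul_assoc, show M + 2 * r + 1 = M + 1 + 2 * r by ring, hB']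
    simp only [mul_add, mul_smul_comm, mul_assoc]
    module

end WeylOne

/-! ### Functionals annihilated by operators -/

section Functionals

variable {T W : Type*} [AddCommGroup T] [Module ℝ T] [AddCommGroup W] [Module ℝ W]

theorem comp_one (u : T →ₗ[ℝ] W) : u ∘ₗ (1 : Module.End ℝ T) = u := rfl

theorem comp_finsetSum {ι : Type*} (u : T →ₗ[ℝ] W) (t : Finset ι) (f : ι → Module.End ℝ T) :
    u ∘ₗ (∑ k ∈ t, f k) = ∑ k ∈ t, u ∘ₗ f k := by
  ext x
  simp [LinearMap.sum_apply]

theorem comp_mul_eq_zero {u : T →ₗ[ℝ] W} {a : Module.End ℝ T} (h : u ∘ₗ a = 0)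
    (b : Module.End ℝ T) : u ∘ₗ (a * b) = 0 := by
  rw [Module.End.mul_eq_comp, ← LinearMap.comp_assoc, h, LinearMap.zero_comp]

/-- The value at `b` of the monic polynomial of degree `r` with lower coefficients `a`. -/
def monicValue {A : Type*} [Ring A] [Algebra ℝ A] {r : ℕ} (a : Fin r → ℝ) (b : A) : A :=
  b ^ r + ∑ k : Fin r, a k • b ^ (k : ℕ)

/-- If multiplication by high powers of `w` lowers the order and the leading part of `b ^ r` is
invertible, then a solution of a monic equation in `b` which is killed by `w ^ (M + 1)` is killed
by `w ^ M`. -/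
theorem comp_pow_eq_zero_of_monicValue {u : T →ₗ[ℝ] W} {w b : Module.End ℝ T} {M r s : ℕ}
    {c : ℝ} (hc : c ≠ 0) {B : Module.End ℝ T}
    (h1 : b ^ r * w ^ s = c • w ^ M + w ^ (M + 1) * B)
    (h2 : ∀ k < r, ∃ B, b ^ k * w ^ s = w ^ (M + 1) * B)
    (hw : u ∘ₗ w ^ (M + 1) = 0) (a : Fin r → ℝ) (ha : u ∘ₗ monicValue a b = 0) :
    u ∘ₗ w ^ M = 0 := by
  have h3 := comp_mul_eq_zero ha (w ^ s)
  rw [monicValue, add_mul, h1, Finset.sum_mul] at h3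
  -- The lower powers of `b` leave at least `w ^ (M + 1)` on the left, which `u` kills.
  have h4 : u ∘ₗ (∑ k : Fin r, a k • b ^ (k : ℕ) * w ^ s) = 0 := by
    rw [comp_finsetSum]
    refine Finset.sum_eq_zero fun k _ => ?_
    obtain ⟨B, hB⟩ := h2 k k.2
    rw [smul_mul_assoc, hB, LinearMap.comp_smul, comp_mul_eq_zero hw, smul_zero]
  rw [LinearMap.comp_add, h4, add_zero, LinearMap.comp_add, comp_mul_eq_zero hw, add_zero,
    LinearMap.comp_smul] at h3
  exact (smul_eq_zero.mp h3).resolve_left hc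

/-- A solution cannot be concentrated on a noncharacteristic plane: each power of `h` killing `u`
can be lowered by one, down to `h ^ 0 = 1`. -/
theorem eq_zero_of_noncharacteristic {u : T →ₗ[ℝ] W} {p h R : Module.End ℝ T}
    (hp : p * h = h * p + 1) (hR : R * h = h * R) {N : ℕ} (hN : u ∘ₗ h ^ N = 0)
    {r : ℕ} (a : Fin r → ℝ) (ha : u ∘ₗ monicValue a ((1 / 2 : ℝ) • (p * p) + R) = 0) : u = 0 := by
  induction N with
  | zero => simpa [comp_one] using hN
  | succ M ih =>
    refine ih ?_
    obtain ⟨c, hc, B, hB⟩ := noncharacteristic_pow_mul_pow hp hR M r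
    refine comp_pow_eq_zero_of_monicValue hc hB (fun k hk => ?_) hN a ha
    obtain ⟨C, hC⟩ := noncharacteristic_pow_mul_pow_mem hp hR k (M + 1)
    refine ⟨C * h ^ (2 * r - 2 * k - 1), ?_⟩
    rw [← mul_assoc, ← hC, mul_assoc, ← pow_add]
    congr 2
    omega

/-- The descent in the power of `q` goes on as long as no indicial root is met, that is, down to
`M`. -/
theorem comp_pow_eq_zero_of_radial {u : T →ₗ[ℝ] W} {q d : Module.End ℝ T}
    (h : d * q = q * d + 1) (n : ℝ) {M N : ℕ} (hM : ∀ j > M, 2 * (j : ℝ) - 1 - n ≠ 0)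
    (hN : u ∘ₗ q ^ N = 0) {r : ℕ} (a : Fin r → ℝ) (ha : u ∘ₗ monicValue a (radial n q d) = 0) :
    u ∘ₗ q ^ M = 0 := by
  induction N with
  | zero =>
    have : u = 0 := by simpa [comp_one] using hN
    simp [this]
  | succ N ih =>
    rcases le_or_gt (N + 1) M with hle | hlt
    · obtain ⟨k, rfl⟩ := Nat.exists_eq_add_of_le hle
      rw [pow_add]
      exact comp_mul_eq_zero hN _
    refine ih ?_
    obtain ⟨B, hB⟩ := radial_pow_mul_pow h n (N + 1) r (by omega)
    rw [Nat.add_sub_cancel] at hB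
    refine comp_pow_eq_zero_of_monicValue ?_ hB (fun k hk => ?_) hN a ha
    · refine Finset.prod_ne_zero_iff.mpr fun j _ => mul_ne_zero (by positivity) ?_
      have := hM (N + 1 + j) (by omega)
      push_cast at this ⊢
      exact this
    · obtain ⟨C, hC⟩ := radial_pow_mul_pow_mem h n k (N + 1)
      refine ⟨C * q ^ (r - k - 1), ?_⟩
      rw [← mul_assoc, ← hC, mul_assoc, ← pow_add]
      congr 2
      omega

theorem eq_zero_of_radial_even {u : T →ₗ[ℝ] W} {q d : Module.End ℝ T}
    (h : d * q = q * d + 1) {n : ℕ} (hn : Even n) {N : ℕ}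
    (hN : u ∘ₗ q ^ N = 0) {r : ℕ} (a : Fin r → ℝ)
    (ha : u ∘ₗ monicValue a (radial (n : ℝ) q d) = 0) : u = 0 := by
  have := comp_pow_eq_zero_of_radial (M := 0) h n (fun j _ hj => ?_) hN a ha
  · simpa [comp_one] using this
  · obtain ⟨k, rfl⟩ := hn
    have : (2 * (j : ℤ) - 1 - (k + k)) = 0 := by exact_mod_cast hj
    omega

/-- A polynomial with nonzero constant term is coprime to `b ^ m`. -/
theorem comp_eq_zero_of_comp_pow {u : T →ₗ[ℝ] W} {b : Module.End ℝ T} {m : ℕ}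
    (hm : u ∘ₗ b ^ m = 0) {r : ℕ} (a : Fin r → ℝ) (hr : 0 < r) (h0 : a ⟨0, hr⟩ ≠ 0)
    (ha : u ∘ₗ monicValue a b = 0) : u = 0 := by
  induction m with
  | zero => simpa [comp_one] using hm
  | succ m ih =>
    refine ih ?_
    have h1 := comp_mul_eq_zero ha (b ^ m)
    have hlt : ∀ k, 0 < k → u ∘ₗ (b ^ k * b ^ m) = 0 := by
      intro k hk
      rw [← pow_add, show k + m = m + 1 + (k - 1) by omega, pow_add]
      exact comp_mul_eq_zero hm _
    rw [monicValue, add_mul, LinearMap.comp_add, hlt r hr, zero_add, Finset.sum_mul,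
      comp_finsetSum, Finset.sum_eq_single ⟨0, hr⟩] at h1
    · rw [pow_zero, smul_mul_assoc, one_mul, LinearMap.comp_smul] at h1
      exact (smul_eq_zero.mp h1).resolve_left h0
    · intro k _ hk
      have : 0 < (k : ℕ) := Nat.pos_of_ne_zero fun h => hk (Fin.ext h)
      rw [smul_mul_assoc, LinearMap.comp_smul, hlt k this, smul_zero]
    · simp

theorem eq_zero_of_radial_odd {u : T →ₗ[ℝ] W} {q d : Module.End ℝ T}
    (h : d * q = q * d + 1) {n : ℕ} (hn : Odd n) {N : ℕ}
    (hN : u ∘ₗ q ^ N = 0) {r : ℕ} (a : Fin r → ℝ) (hr : 0 < r) (h0 : a ⟨0, hr⟩ ≠ 0)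
    (ha : u ∘ₗ monicValue a (radial (n : ℝ) q d) = 0) : u = 0 := by
  obtain ⟨k, rfl⟩ := hn
  -- For `n = 2 k + 1` the indicial root is `k + 1`. The descent stops there, and `radial_pow_self`
  -- takes over with the same exponent.
  have hq := comp_pow_eq_zero_of_radial (M := k + 1) h ((2 * k + 1 : ℕ) : ℝ)
    (fun j hj hj' => ?_) hN a ha
  · obtain ⟨B, hB⟩ := radial_pow_self h (k + 1)
    have e : ((2 * k + 1 : ℕ) : ℝ) = 2 * ((k + 1 : ℕ) : ℝ) - 1 := by push_cast; ring
    rw [e] at ha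
    refine comp_eq_zero_of_comp_pow (m := k + 1) ?_ a hr h0 ha
    rw [hB]
    exact comp_mul_eq_zero hq B
  · have : (2 * (j : ℤ) - 1 - (2 * k + 1)) = 0 := by exact_mod_cast hj'
    omega

/-- A vector field `P` with `P h = -y` crosses `h = 0` transversally where `y ≠ 0`; each application
trades one factor `h` for one factor `y`, up to a nonzero scalar. -/
theorem transversal_pow_mul_pow {A : Type*} [Ring A] [Algebra ℝ A] {P h y : A}
    (hP : P * h = h * P - y) (hhy : h * y = y * h) (s M : ℕ) :
    ∃ c : ℝ, c ≠ 0 ∧ ∃ B, P ^ s * h ^ (M + s) = c • (y ^ s * h ^ M) + h ^ (M + 1) * B := by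
  have hyh : ∀ i j, y ^ i * h ^ j = h ^ j * y ^ i := fun i j =>
    (Commute.pow_pow (show Commute y h from hhy.symm) i j)
  have h1 : ∀ K : ℕ, P * h ^ (K + 1) = h ^ (K + 1) * P - (K + 1 : ℝ) • (h ^ K * y) := by
    intro K
    induction K with
    | zero => simp [hP]
    | succ K ih =>
      rw [pow_succ, ← mul_assoc, ih, sub_mul, mul_assoc, hP, mul_sub, smul_mul_assoc,
        mul_assoc (h ^ K), ← hhy, ← mul_assoc (h ^ K), ← pow_succ, ← mul_assoc]
      push_cast
      module
  induction s generalizing M with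
  | zero => exact ⟨1, one_ne_zero, 0, by simp⟩
  | succ s ih =>
    obtain ⟨c, hc, B, hB⟩ := ih M
    obtain ⟨c', -, B', hB'⟩ := ih (M + 1)
    refine ⟨-((M + s : ℕ) + 1 : ℝ) * c, mul_ne_zero (neg_ne_zero.mpr (by positivity)) hc,
      (c' • y ^ s + h * B') * P - ((M + s : ℕ) + 1 : ℝ) • (B * y), ?_⟩
    have e : P ^ (s + 1) * h ^ (M + (s + 1)) =
        P ^ s * h ^ (M + 1 + s) * P - ((M + s : ℕ) + 1 : ℝ) • (P ^ s * h ^ (M + s) * y) := by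
      rw [pow_succ, mul_assoc, ← add_assoc, h1, mul_sub, mul_smul_comm, mul_assoc, mul_assoc,
        show M + s + 1 = M + 1 + s by ring]
    have e2 : y ^ s * h ^ M * y = y ^ (s + 1) * h ^ M := by
      rw [mul_assoc, (by simpa using (hyh 1 M).symm : h ^ M * y = y * h ^ M), ← mul_assoc, ← pow_succ]
    rw [e, hB', hB, hyh s (M + 1), add_mul _ _ y, smul_mul_assoc _ _ y, e2, pow_succ h (M + 1)]
    simp only [add_mul, mul_add, mul_sub, mul_smul_comm, smul_mul_assoc, mul_assoc]
    module

/-- A functional concentrated on `h = 0` and killed by a power of a field transversal to it where `y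
≠ 0` must be concentrated on `y = 0`. It is used with `P = L_X`, which is nilpotent on the values.
-/
theorem comp_pow_pow_eq_zero {u : T →ₗ[ℝ] W} {P h y : Module.End ℝ T}
    (hP : P * h = h * P - y) (hPy : P * y = y * P) (hhy : h * y = y * h) {s L : ℕ}
    (hs : u ∘ₗ P ^ s = 0) (hL : u ∘ₗ h ^ L = 0) : ∃ J, u ∘ₗ y ^ J = 0 := by
  induction L generalizing u with
  | zero => exact ⟨0, by simpa using hL⟩
  | succ M ih =>
    obtain ⟨c, hc, B, hB⟩ := transversal_pow_mul_pow hP hhy s M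
    have h1 := comp_mul_eq_zero hs (h ^ (M + s))
    rw [hB, LinearMap.comp_add, comp_mul_eq_zero hL, add_zero, LinearMap.comp_smul] at h1
    have h2 := (smul_eq_zero.mp h1).resolve_left hc
    -- Composing with `y ^ s` lowers the power of `h` by one; it preserves the equation `u ∘ P ^ s =
    -- 0` because `P` and `y` commute.
    obtain ⟨J, hJ⟩ := ih (u := u ∘ₗ y ^ s) (by
      rw [LinearMap.comp_assoc, ← Module.End.mul_eq_comp,
        ← (Commute.pow_pow (show Commute P y from hPy) s s).eq]
      exact comp_mul_eq_zero hs _) (by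
      rw [LinearMap.comp_assoc, ← Module.End.mul_eq_comp]
      exact h2)
    exact ⟨s + J, by rw [pow_add, Module.End.mul_eq_comp, ← LinearMap.comp_assoc]; exact hJ⟩

end Functionals

/-! ### The Casimir operator in the Weyl algebra of three variables -/

section WeylThree

variable {A : Type*} [Ring A]

/-- The relations between the coordinates `h, x, y` on `𝔤` and the partial derivatives
`p, r, s`. -/
structure WeylRelations (h x y p r s : A) : Prop where
  xh : x * h = h * x
  yh : y * h = h * y
  yx : y * x = x * y
  ph : p * h = h * p + 1
  px : p * x = x * p
  py : p * y = y * p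
  rh : r * h = h * r
  rx : r * x = x * r + 1
  ry : r * y = y * r
  sh : s * h = h * s
  sx : s * x = x * s
  sy : s * y = y * s + 1
  rp : r * p = p * r
  sp : s * p = p * s
  sr : s * r = r * s

variable [Algebra ℝ A] {h x y p r s : A} (w : WeylRelations h x y p r s)

/-- The Casimir operator. -/
def box (p r s : A) : A := (1 / 2 : ℝ) • (p * p) + (2 : ℝ) • (r * s)

omit [Algebra ℝ A] in
theorem left_comm_of {a b c : A} (e : a * b = c) (z : A) : a * (b * z) = c * z := by
  rw [← mul_assoc, e]

include w

/-- The Casimir operator is invariant, so it commutes with the fields `L_X`, `L_Y`, `L_H`; this and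
the next two identities check it in coordinates. -/
theorem box_comm_lieX : box p r s * ((2 : ℝ) • (h * r) - y * p) =
    ((2 : ℝ) • (h * r) - y * p) * box p r s := by
  obtain ⟨xh, yh, yx, ph, px, py, rh, rx, ry, sh, sx, sy, rp, sp, sr⟩ := w
  simp only [box, add_mul, mul_add, sub_mul, mul_sub, smul_mul_assoc, mul_smul_comm, mul_assoc,
    rp, sp, sr, left_comm_of ph, left_comm_of py, left_comm_of rh,
    left_comm_of ry, left_comm_of sh, left_comm_of sy, left_comm_of rp,
    one_mul]
  module

theorem box_comm_lieY : box p r s * (x * p - (2 : ℝ) • (h * s)) =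
    (x * p - (2 : ℝ) • (h * s)) * box p r s := by
  obtain ⟨xh, yh, yx, ph, px, py, rh, rx, ry, sh, sx, sy, rp, sp, sr⟩ := w
  simp only [box, add_mul, mul_add, sub_mul, mul_sub, smul_mul_assoc, mul_smul_comm, mul_assoc,
    sp, left_comm_of ph, left_comm_of px, left_comm_of rh,
    left_comm_of rx, left_comm_of sh, left_comm_of sx, left_comm_of rp, left_comm_of sp,
    left_comm_of sr, one_mul]
  module

theorem box_comm_lieH : box p r s * ((2 : ℝ) • (y * s) - (2 : ℝ) • (x * r)) =
    ((2 : ℝ) • (y * s) - (2 : ℝ) • (x * r)) * box p r s := by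
  obtain ⟨xh, yh, yx, ph, px, py, rh, rx, ry, sh, sx, sy, rp, sp, sr⟩ := w
  simp only [box, add_mul, mul_add, sub_mul, mul_sub, smul_mul_assoc, mul_smul_comm, mul_assoc,
    rp, sp, sr, left_comm_of px, left_comm_of py,
    left_comm_of rx, left_comm_of ry, left_comm_of sx, left_comm_of sy, left_comm_of rp,
    left_comm_of sp, left_comm_of sr, one_mul]
  module

omit [Algebra ℝ A] in
theorem weyl_inv_comm {i : A} (hxi : x * i = 1) (hix : i * x = 1) :
    i * h = h * i ∧ i * y = y * i ∧ p * i = i * p ∧ s * i = i * s ∧ r * i = i * r - i * i := by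
  obtain ⟨xh, yh, yx, ph, px, py, rh, rx, ry, sh, sx, sy, rp, sp, sr⟩ := w
  have key : ∀ z, z * x = x * z → i * z = z * i := by
    intro z hz
    calc i * z = i * (z * x) * i := by rw [mul_assoc, mul_assoc, hxi, mul_one]
      _ = z * i := by rw [hz, ← mul_assoc, hix, one_mul]
  refine ⟨key h xh.symm, key y yx, (key p px).symm, (key s sx).symm, ?_⟩
  have : i * (r * x) * i = i * (x * r) * i + i * i := by rw [rx, mul_add, add_mul, mul_one]
  rw [mul_assoc, mul_assoc, hxi, mul_one, ← mul_assoc i, hix, one_mul] at this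
  rw [this]
  abel

-- `x⁻¹ ∂_Y` is a derivative transversal to the cone: it takes `h² + xy` to `1`.
omit [Algebra ℝ A] in
theorem weyl_cone_comm {i : A} (hxi : x * i = 1) (hix : i * x = 1) :
    (i * s) * (h * h + x * y) = (h * h + x * y) * (i * s) + 1 := by
  obtain ⟨ih, iy, pi, si, ri⟩ := weyl_inv_comm w hxi hix
  obtain ⟨xh, yh, yx, ph, px, py, rh, rx, ry, sh, sx, sy, rp, sp, sr⟩ := w
  simp only [add_mul, mul_add, mul_assoc, sh, sy, left_comm_of sh, left_comm_of sx,
    left_comm_of ih, left_comm_of hix, left_comm_of iy.symm, hix, left_comm_of hxi, mul_one,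
    one_mul]
  abel

/-- The radial part formula. The factors `L_Y` and `L_H - n` stand on the left, so both terms
containing them vanish after composition with a functional of weight `n` killed by `L_Y`. -/
theorem box_eq_radial {i : A} (hxi : x * i = 1) (hix : i * x = 1) (n : ℝ) :
    box p r s = (x * p - (2 : ℝ) • (h * s)) * (i * ((1 / 2 : ℝ) • p + h * (i * s))) +
      ((2 : ℝ) • (y * s) - (2 : ℝ) • (x * r) - n • 1) * (-(i * s)) +
      radial n (h * h + x * y) (i * s) := by
  obtain ⟨ih, iy, pi, si, ri⟩ := weyl_inv_comm w hxi hix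
  obtain ⟨xh, yh, yx, ph, px, py, rh, rx, ry, sh, sx, sy, rp, sp, sr⟩ := w
  have hi := ih.symm
  have yi := iy.symm
  have xi := hxi
  simp only [box, radial, add_mul, mul_add, sub_mul, mul_sub, smul_mul_assoc, mul_smul_comm,
    mul_assoc, mul_neg,
    sy, sh, sp, hix,
    left_comm_of ph, left_comm_of pi,
    left_comm_of ri,
    left_comm_of sx, left_comm_of sh, left_comm_of si,
    left_comm_of ih, left_comm_of hix,
    left_comm_of hxi, left_comm_of yi, left_comm_of xh,
    one_mul, mul_one]
  module

end WeylThree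

/-! ### Differential operators on test functions supported in a compact set -/

/-- An entry of a matrix in `𝔤`, as a continuous linear functional. -/
def entry (i j : Fin 2) : sl2 →L[ℝ] ℝ :=
  LinearMap.toContinuousLinearMap
    { toFun := fun Z => mat Z i j
      map_add' := fun Z Z' => by simp
      map_smul' := fun c Z => by simp }

theorem entry_apply (i j : Fin 2) (Z : sl2) : entry i j Z = mat Z i j := rfl

theorem eq_combination (Z : sl2) :
    Z = mat Z 0 0 • H + mat Z 0 1 • X + mat Z 1 0 • Y := by
  apply mat_injective
  have h := trace_mat Z
  rw [Matrix.trace_fin_two] at h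
  simp only [map_add, map_smul, H, X, Y, mat_ofCoords]
  ext i j
  fin_cases i <;> fin_cases j <;> simp
  linarith

section Operators

variable (K : Compacts sl2)

/-- The derivative in the direction `v`. -/
def derivOp (v : sl2) : Module.End ℝ 𝓓_{K}(sl2, ℝ) where
  toFun f :=
    { toFun := fun P => fderiv ℝ f P v
      contDiff' := (f.contDiff.fderiv_right le_rfl).clm_apply contDiff_const
      zero_on_compl' := fun P hP => by
        have : fderiv ℝ f P = 0 := by
          have h := (support_fderiv_subset ℝ (f := f)).trans f.tsupport_subset
          by_contra h0
          exact hP (h h0)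
        simp [this] }
  map_add' f g := by
    ext P
    have hf : DifferentiableAt ℝ f P := (f.contDiff.differentiable (by simp)).differentiableAt
    have hg : DifferentiableAt ℝ g P := (g.contDiff.differentiable (by simp)).differentiableAt
    change fderiv ℝ (⇑f + ⇑g) P v = fderiv ℝ f P v + fderiv ℝ g P v
    rw [fderiv_add hf hg]
    rfl
  map_smul' c f := by
    ext P
    have hf : DifferentiableAt ℝ f P := (f.contDiff.differentiable (by simp)).differentiableAt
    change fderiv ℝ (c • ⇑f) P v = c • fderiv ℝ f P v
    rw [fderiv_const_smul hf]
    rfl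

/-- Multiplication by a function which is smooth on `K`. -/
def mulOp (g : sl2 → ℝ) (hg : ∀ P ∈ K, ContDiffAt ℝ ((⊤ : ℕ∞) : WithTop ℕ∞) g P) :
    Module.End ℝ 𝓓_{K}(sl2, ℝ) where
  toFun f :=
    { toFun := fun P => g P * f P
      contDiff' := contDiff_iff_contDiffAt.mpr fun P => by
        by_cases hP : P ∈ (K : Set sl2)
        · exact (hg P hP).mul f.contDiff.contDiffAt
        · have : (fun P => g P * f P) =ᶠ[nhds P] fun _ => 0 := by
            filter_upwards [K.isCompact.isClosed.isOpen_compl.mem_nhds hP] with Q hQ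
            rw [f.zero_on_compl hQ]
            simp
          exact contDiffAt_const.congr_of_eventuallyEq this
      zero_on_compl' := fun P hP => by simp [f.zero_on_compl hP] }
  map_add' f f' := by ext P; exact mul_add _ _ _
  map_smul' c f := by ext P; exact mul_left_comm _ _ _

variable {K}

@[simp] theorem derivOp_apply (v : sl2) (f : 𝓓_{K}(sl2, ℝ)) (P : sl2) :
    derivOp K v f P = fderiv ℝ f P v := rfl

@[simp] theorem mulOp_apply (g : sl2 → ℝ) (hg) (f : 𝓓_{K}(sl2, ℝ)) (P : sl2) :
    mulOp K g hg f P = g P * f P := rfl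

theorem mulOp_comm (g g' : sl2 → ℝ) (hg hg') :
    mulOp K g hg * mulOp K g' hg' = mulOp K g' hg' * mulOp K g hg := by
  ext f P
  exact mul_left_comm _ _ _

theorem mulOp_pow (g : sl2 → ℝ) (hg) (N : ℕ) (f : 𝓓_{K}(sl2, ℝ)) (P : sl2) :
    (mulOp K g hg ^ N) f P = g P ^ N * f P := by
  induction N generalizing f with
  | zero => simp
  | succ N ih => rw [pow_succ, Module.End.mul_apply, ih, mulOp_apply, pow_succ, mul_assoc]

theorem derivOp_comm (v v' : sl2) : derivOp K v * derivOp K v' = derivOp K v' * derivOp K v := by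
  ext f P
  change fderiv ℝ (fun Q => fderiv ℝ f Q v') P v = fderiv ℝ (fun Q => fderiv ℝ f Q v) P v'
  have hd : DifferentiableAt ℝ (fderiv ℝ f) P :=
    ((f.contDiff.fderiv_right (m := 1) (by norm_cast)).differentiable (by simp)).differentiableAt
  have hs : IsSymmSndFDerivAt ℝ f P := by
    refine f.contDiff.contDiffAt.isSymmSndFDerivAt ?_
    rw [minSmoothness_of_isRCLikeNormedField]
    exact WithTop.coe_le_coe.mpr (le_top : (2 : ℕ∞) ≤ ⊤)
  rw [fderiv_clm_apply hd (differentiableAt_const _), fderiv_clm_apply hd (differentiableAt_const _)]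
  simpa using hs v v'

/-- The Leibniz rule for a linear function; it is the source of the canonical commutation relations.
-/
theorem derivOp_mul_mulOp (v : sl2) (ℓ : sl2 →L[ℝ] ℝ) (hℓ) :
    derivOp K v * mulOp K ℓ hℓ = mulOp K ℓ hℓ * derivOp K v + ℓ v • 1 := by
  ext f P
  have hf : DifferentiableAt ℝ f P := (f.contDiff.differentiable (by simp)).differentiableAt
  change fderiv ℝ (fun Q => ℓ Q * f Q) P v = ℓ P * fderiv ℝ f P v + ℓ v * f P
  rw [fderiv_fun_mul ℓ.differentiableAt hf]
  simp
  ring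

variable (K)

theorem contDiffAt_entry (i j : Fin 2) (P : sl2) :
    ContDiffAt ℝ ((⊤ : ℕ∞) : WithTop ℕ∞) (entry i j) P := (entry i j).contDiff.contDiffAt

/-- Multiplication by an entry. -/
def entryOp (i j : Fin 2) : Module.End ℝ 𝓓_{K}(sl2, ℝ) :=
  mulOp K (entry i j) fun P _ => contDiffAt_entry i j P

theorem weylRelations : WeylRelations (entryOp K 0 0) (entryOp K 0 1) (entryOp K 1 0)
    (derivOp K H) (derivOp K X) (derivOp K Y) := by
  constructor <;> first
    | exact mulOp_comm _ _ _ _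
    | exact derivOp_comm _ _
    | (rw [entryOp, derivOp_mul_mulOp]; simp [entry_apply, H, X, Y, mat_ofCoords])

/-- Multiplication by `h² + x y`. -/
def coneOp : Module.End ℝ 𝓓_{K}(sl2, ℝ) :=
  entryOp K 0 0 * entryOp K 0 0 + entryOp K 0 1 * entryOp K 1 0

/-- The action `f ↦ L_Z f` of `𝔤` on test functions. -/
def lieOp (Z : sl2) : Module.End ℝ 𝓓_{K}(sl2, ℝ) :=
  mat Z 0 0 • ((2 : ℝ) • (entryOp K 1 0 * derivOp K Y) - (2 : ℝ) • (entryOp K 0 1 * derivOp K X)) +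
  mat Z 0 1 • ((2 : ℝ) • (entryOp K 0 0 * derivOp K X) - entryOp K 1 0 * derivOp K H) +
  mat Z 1 0 • (entryOp K 0 1 * derivOp K H - (2 : ℝ) • (entryOp K 0 0 * derivOp K Y))

theorem lieOp_H : lieOp K H = (2 : ℝ) • (entryOp K 1 0 * derivOp K Y) -
    (2 : ℝ) • (entryOp K 0 1 * derivOp K X) := by simp [lieOp, H, mat_ofCoords]

theorem lieOp_X : lieOp K X = (2 : ℝ) • (entryOp K 0 0 * derivOp K X) -
    entryOp K 1 0 * derivOp K H := by simp [lieOp, X, mat_ofCoords]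

theorem lieOp_Y : lieOp K Y = entryOp K 0 1 * derivOp K H -
    (2 : ℝ) • (entryOp K 0 0 * derivOp K Y) := by simp [lieOp, Y, mat_ofCoords]

/-- The Casimir operator on test functions. -/
def boxOp : Module.End ℝ 𝓓_{K}(sl2, ℝ) := box (derivOp K H) (derivOp K X) (derivOp K Y)

theorem boxOp_comm_lieOp (Z : sl2) : boxOp K * lieOp K Z = lieOp K Z * boxOp K := by
  have w := weylRelations K
  rw [lieOp, boxOp, mul_add, mul_add, add_mul, add_mul]
  simp only [mul_smul_comm _ (box _ _ _), smul_mul_assoc _ _ (box _ _ _), box_comm_lieX w, box_comm_lieY w, box_comm_lieH w]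

theorem lieOp_apply (Z : sl2) (f : 𝓓_{K}(sl2, ℝ)) (P : sl2) :
    lieOp K Z f P = fderiv ℝ f P (-⁅Z, P⁆) := by
  have hb : -⁅Z, P⁆ =
      (mat Z 1 0 * mat P 0 1 - mat Z 0 1 * mat P 1 0) • H +
      (2 * mat Z 0 1 * mat P 0 0 - 2 * mat Z 0 0 * mat P 0 1) • X +
      (2 * mat Z 0 0 * mat P 1 0 - 2 * mat Z 1 0 * mat P 0 0) • Y := by
    rw [eq_combination (-⁅Z, P⁆)]
    have hZ := trace_mat Z
    have hP := trace_mat P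
    rw [Matrix.trace_fin_two] at hZ hP
    have hZ' : mat Z 1 1 = -mat Z 0 0 := by linarith
    have hP' : mat P 1 1 = -mat P 0 0 := by linarith
    congr 2
    · congr 2
      simp [mat_lie, Matrix.mul_apply, Fin.sum_univ_two]
      ring
    · congr 1
      simp [mat_lie, Matrix.mul_apply, Fin.sum_univ_two, hZ', hP']
      ring
    · simp [mat_lie, Matrix.mul_apply, Fin.sum_univ_two, hZ', hP']
      ring
  rw [hb, map_add, map_add, map_smul, map_smul, map_smul]
  change mat Z 0 0 * (2 * (mat P 1 0 * fderiv ℝ f P Y) - 2 * (mat P 0 1 * fderiv ℝ f P X)) +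
    mat Z 0 1 * (2 * (mat P 0 0 * fderiv ℝ f P X) - mat P 1 0 * fderiv ℝ f P H) +
    mat Z 1 0 * (mat P 0 1 * fderiv ℝ f P H - 2 * (mat P 0 0 * fderiv ℝ f P Y)) = _
  simp only [smul_eq_mul]
  ring

end Operators

/-! ### Generalized functions as functionals on the test functions supported in a compact set -/

section OnCompact

variable {U : Opens sl2} {E : Type*} [AddCommGroup E] [Module ℝ E] [TopologicalSpace E]
  {K : Compacts sl2}

/-- The restriction of a generalized function to the test functions supported in `K`. -/
def onCompact (hK : (K : Set sl2) ⊆ U) (φ : 𝓓'(U, E)) : 𝓓_{K}(sl2, ℝ) →ₗ[ℝ] E where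
  toFun f := φ (TestFunction.ofSupportedIn hK f)
  map_add' f g := map_add φ (TestFunction.ofSupportedIn hK f) (TestFunction.ofSupportedIn hK g)
  map_smul' c f := map_smul φ c (TestFunction.ofSupportedIn hK f)

theorem onCompact_apply (hK : (K : Set sl2) ⊆ U) (φ : 𝓓'(U, E)) (f : 𝓓_{K}(sl2, ℝ)) :
    onCompact hK φ f = φ (TestFunction.ofSupportedIn hK f) := rfl

/-- The support of a test function, as a compact set. -/
def supportCompact (f : 𝓓(U, ℝ)) : Compacts sl2 := ⟨tsupport f, f.hasCompactSupport⟩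

theorem supportCompact_subset (f : 𝓓(U, ℝ)) : (supportCompact f : Set sl2) ⊆ U :=
  f.tsupport_subset

/-- A test function, as a function supported in its support. -/
def onSupport (f : 𝓓(U, ℝ)) : 𝓓_{supportCompact f}(sl2, ℝ) :=
  .of_support_subset f.contDiff subset_closure

theorem apply_eq_onCompact (φ : 𝓓'(U, E)) (f : 𝓓(U, ℝ)) : φ f =
    onCompact (supportCompact_subset f) φ (onSupport f) := rfl

theorem onCompact_invariant [LieRingModule sl2 E] {φ : 𝓓'(U, E)} (h : IsLocallyInvariant φ)
    (hK : (K : Set sl2) ⊆ U) (Z : sl2) (f : 𝓓_{K}(sl2, ℝ)) :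
    onCompact hK φ (lieOp K Z f) = ⁅Z, onCompact hK φ f⁆ := by
  have h1 := h Z (TestFunction.ofSupportedIn hK f)
  rw [add_neg_eq_zero] at h1
  rw [onCompact_apply, onCompact_apply, h1]
  congr 1
  ext P
  exact lieOp_apply K Z f P

theorem isLocallyInvariant_of_onCompact [LieRingModule sl2 E] {φ : 𝓓'(U, E)}
    (h : ∀ (K : Compacts sl2) (hK : (K : Set sl2) ⊆ U) (Z : sl2) (f : 𝓓_{K}(sl2, ℝ)),
      onCompact hK φ (lieOp K Z f) = ⁅Z, onCompact hK φ f⁆) : IsLocallyInvariant φ := by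
  intro Z f
  rw [add_neg_eq_zero, apply_eq_onCompact, ← h, onCompact_apply]
  congr 1
  ext P
  exact lieOp_apply _ Z _ P

variable [IsTopologicalAddGroup E] [ContinuousSMul ℝ E]

theorem onCompact_zero (hK : (K : Set sl2) ⊆ U) : onCompact hK (0 : 𝓓'(U, E)) = 0 := rfl

theorem eq_zero_of_onCompact {φ : 𝓓'(U, E)}
    (h : ∀ (K : Compacts sl2) (hK : (K : Set sl2) ⊆ U), onCompact hK φ = 0) : φ = 0 := by
  refine DFunLike.ext _ _ fun f => ?_
  rw [apply_eq_onCompact, h]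
  rfl

theorem onCompact_add (hK : (K : Set sl2) ⊆ U) (φ ψ : 𝓓'(U, E)) :
    onCompact hK (φ + ψ) = onCompact hK φ + onCompact hK ψ := rfl

theorem onCompact_smul (hK : (K : Set sl2) ⊆ U) (c : ℝ) (φ : 𝓓'(U, E)) :
    onCompact hK (c • φ) = c • onCompact hK φ := rfl

theorem onCompact_sum (hK : (K : Set sl2) ⊆ U) {ι : Type*} (t : Finset ι) (φ : ι → 𝓓'(U, E)) :
    onCompact hK (∑ k ∈ t, φ k) = ∑ k ∈ t, onCompact hK (φ k) :=
  map_sum (⟨⟨onCompact hK, onCompact_zero hK⟩, onCompact_add hK⟩ : 𝓓'(U, E) →+ _) φ t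

theorem lineDerivOp_testFunction_apply (f : 𝓓(U, ℝ)) (v P : sl2) :
    (∂_{v} f) P = fderiv ℝ f P v := by
  rw [TestFunction.lineDerivOp_eq_lineDerivCLM ℝ, TestFunction.lineDerivCLM_eq_fderivCLM,
    TestFunction.fderivCLM_apply_of_le _ (by simp)]

theorem onCompact_casimir (hK : (K : Set sl2) ⊆ U) (φ : 𝓓'(U, E)) :
    onCompact hK (casimir φ) = onCompact hK φ ∘ₗ boxOp K := by
  -- Transposing two derivatives produces two signs, which cancel, and reverses their order.
  have key : ∀ (v v' : sl2) (f : 𝓓_{K}(sl2, ℝ)), (∂_{v} (∂_{v'} φ)) (TestFunction.ofSupportedIn hK f) =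
      onCompact hK φ (derivOp K v' (derivOp K v f)) := by
    intro v v' f
    rw [Distribution.lineDerivOp_apply_apply, Distribution.lineDerivOp_apply_apply]
    rw [onCompact_apply]
    congr 1
    rw [← LineDeriv.lineDerivOpCLM_apply (R := ℝ), ← LineDeriv.lineDerivOpCLM_apply (R := ℝ), map_neg, neg_neg]
    ext P
    rw [LineDeriv.lineDerivOpCLM_apply, LineDeriv.lineDerivOpCLM_apply, lineDerivOp_testFunction_apply]
    have : ⇑(∂_{v} (TestFunction.ofSupportedIn hK f) : 𝓓(U, ℝ)) = ⇑(derivOp K v f) :=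
      funext fun Q => lineDerivOp_testFunction_apply _ v Q
    rw [this]
    rfl
  ext f
  change (1 / 2 : ℝ) • (∂_{H} (∂_{H} φ)) (TestFunction.ofSupportedIn hK f) +
    (2 : ℝ) • (∂_{Y} (∂_{X} φ)) (TestFunction.ofSupportedIn hK f) = _
  rw [key, key]
  simp only [boxOp, box, LinearMap.comp_apply, LinearMap.add_apply, LinearMap.smul_apply, map_add,
    map_smul, Module.End.mul_apply]

theorem onCompact_casimir_iterate (hK : (K : Set sl2) ⊆ U) (φ : 𝓓'(U, E)) (k : ℕ) :
    onCompact hK (casimir^[k] φ) = onCompact hK φ ∘ₗ boxOp K ^ k := by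
  induction k with
  | zero => rfl
  | succ k ih =>
    rw [Function.iterate_succ_apply', onCompact_casimir, ih, LinearMap.comp_assoc, pow_succ]
    rfl

theorem onCompact_monicValue (hK : (K : Set sl2) ⊆ U) (φ : 𝓓'(U, E)) {r : ℕ} (a : Fin r → ℝ) :
    onCompact hK (casimir^[r] φ + ∑ k : Fin r, a k • casimir^[(k : ℕ)] φ) =
      onCompact hK φ ∘ₗ monicValue a (boxOp K) := by
  simp only [monicValue, LinearMap.comp_add, comp_finsetSum, LinearMap.comp_smul,
    ← onCompact_casimir_iterate, onCompact_add, onCompact_sum, onCompact_smul]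

end OnCompact

/-! ### Generalized functions supported in the zero set of a function -/

theorem exists_uniform_bound {α : Type*} {F : ℕ → α → ℝ} (M : ℕ)
    (h : ∀ i ≤ M, ∃ C, ∀ x, F i x ≤ C) : ∃ C, 1 ≤ C ∧ ∀ i ≤ M, ∀ x, F i x ≤ C := by
  choose! b hb using h
  refine ⟨1 + ∑ i ∈ Finset.range (M + 1), |b i|, ?_, fun i hi x => ?_⟩
  · have : 0 ≤ ∑ i ∈ Finset.range (M + 1), |b i| := Finset.sum_nonneg fun _ _ => abs_nonneg _
    linarith
  · have h1 : |b i| ≤ ∑ i ∈ Finset.range (M + 1), |b i| :=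
      Finset.single_le_sum (f := fun i => |b i|) (fun _ _ => abs_nonneg _)
        (Finset.mem_range.mpr (by omega))
    have h2 := hb i hi x
    have h3 := le_abs_self (b i)
    linarith

/-- Continuity gives a bound by finitely many seminorms, so the order on a fixed compact set is
finite. -/
theorem exists_order_bound {K : Compacts sl2} {G : Type*} [NormedAddCommGroup G] [NormedSpace ℝ G]
    (ψ : 𝓓_{K}(sl2, ℝ) →L[ℝ] G) : ∃ (M : ℕ) (C : ℝ), 0 ≤ C ∧ ∀ (f : 𝓓_{K}(sl2, ℝ)) (B : ℝ), 0 ≤ B →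
      (∀ i ≤ M, ∀ P ∈ K, ‖iteratedFDeriv ℝ i f P‖ ≤ B) → ‖ψ f‖ ≤ C * B := by
  obtain ⟨s, C, -, hC⟩ := Seminorm.bound_of_continuous
    (ContDiffMapSupportedIn.withSeminorms ℝ sl2 ℝ ⊤ K) ((normSeminorm ℝ G).comp ψ.toLinearMap)
    (continuous_norm.comp ψ.continuous)
  refine ⟨s.sup id, C, C.2, fun f B hB hf => ?_⟩
  have h1 : ‖ψ f‖ ≤ C * (s.sup (ContDiffMapSupportedIn.seminorm ℝ sl2 ℝ ⊤ K)) f := hC f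
  refine h1.trans (mul_le_mul_of_nonneg_left ?_ C.2)
  refine Seminorm.finset_sup_apply_le hB fun i hi => ?_
  rw [ContDiffMapSupportedIn.seminorm_top_le_iff ℝ hB]
  exact hf i (Finset.le_sup (f := id) hi)

/-- Each derivative falling on `η (s w)` costs at most one factor `s`, hence `s ^ M` for all orders
up to `M`. -/
theorem iteratedFDeriv_cutoff_le {η : ℝ → ℝ} (hη : ContDiff ℝ ((⊤ : ℕ∞) : WithTop ℕ∞) η)
    {w f : sl2 → ℝ} (hw : ContDiff ℝ ((⊤ : ℕ∞) : WithTop ℕ∞) w)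
    (hf : ContDiff ℝ ((⊤ : ℕ∞) : WithTop ℕ∞) f) {M : ℕ} {P : sl2} {A B D : ℝ}
    (hA : ∀ i ≤ M, ∀ t, ‖iteratedFDeriv ℝ i η t‖ ≤ A)
    (hB : ∀ i ≤ M, ‖iteratedFDeriv ℝ i w P‖ ≤ B) (hB1 : 1 ≤ B)
    (hD : ∀ i ≤ M, ‖iteratedFDeriv ℝ i f P‖ ≤ D) {s : ℝ} (hs : 1 ≤ s) {i : ℕ} (hi : i ≤ M) :
    ‖iteratedFDeriv ℝ i (fun Q => η (s * w Q) * f Q) P‖ ≤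
      (2 ^ M * (M.factorial * A * B ^ M) * D) * s ^ M := by
  have hA0 : 0 ≤ A := (norm_nonneg _).trans (hA 0 (Nat.zero_le _) 0)
  have hD0 : 0 ≤ D := (norm_nonneg _).trans (hD 0 (Nat.zero_le _))
  have hsw : ContDiff ℝ ((⊤ : ℕ∞) : WithTop ℕ∞) (fun Q => s * w Q) := contDiff_const.mul hw
  have hle : ∀ j : ℕ, ((j : ℕ) : WithTop ℕ∞) ≤ ((⊤ : ℕ∞) : WithTop ℕ∞) := fun j =>
    WithTop.coe_le_coe.mpr le_top
  have hcomp : ∀ j ≤ M, ‖iteratedFDeriv ℝ j (fun Q => η (s * w Q)) P‖ ≤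
      M.factorial * A * B ^ M * s ^ M := by
    intro j hj
    have h1 := norm_iteratedFDeriv_comp_le (n := j) (C := A) (D := s * B) hη hsw (hle j) P
      (fun k hk => hA k (hk.trans hj) _) (fun k hk1 hk => by
        have : iteratedFDeriv ℝ k (fun Q => s * w Q) P = s • iteratedFDeriv ℝ k w P := by
          rw [show (fun Q => s * w Q) = s • w from rfl]
          exact iteratedFDeriv_const_smul_apply (hw.contDiffAt.of_le (hle k))
        rw [this, norm_smul, Real.norm_of_nonneg (by linarith)]
        refine (mul_le_mul_of_nonneg_left (hB k (hk.trans hj)) (by linarith)).trans ?_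
        exact le_self_pow₀ (by nlinarith) (by omega))
    refine h1.trans ?_
    rw [mul_pow, mul_assoc (_ * A), mul_comm (B ^ M)]
    have e1 : (j.factorial : ℝ) ≤ M.factorial := by exact_mod_cast Nat.factorial_le hj
    have e2 : s ^ j ≤ s ^ M := pow_le_pow_right₀ hs hj
    have e3 : B ^ j ≤ B ^ M := pow_le_pow_right₀ hB1 hj
    have : 0 ≤ s := by linarith
    gcongr
  refine (norm_iteratedFDeriv_mul_le (hη.comp hsw) hf P (hle i)).trans ?_
  calc ∑ j ∈ Finset.range (i + 1), (i.choose j : ℝ) * ‖iteratedFDeriv ℝ j (fun Q => η (s * w Q)) P‖ *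
        ‖iteratedFDeriv ℝ (i - j) f P‖
      ≤ ∑ j ∈ Finset.range (i + 1), (i.choose j : ℝ) * (M.factorial * A * B ^ M * s ^ M) * D := by
        refine Finset.sum_le_sum fun j hj => ?_
        rw [Finset.mem_range] at hj
        have e1 := hcomp j (by omega)
        have e2 := hD (i - j) (by omega)
        gcongr
    _ = 2 ^ i * (M.factorial * A * B ^ M * s ^ M * D) := by
        rw [← Finset.sum_mul, ← Finset.sum_mul]
        have : (∑ j ∈ Finset.range (i + 1), (i.choose j : ℝ)) = 2 ^ i := by
          exact_mod_cast Nat.sum_range_choose i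
        rw [this]
        ring
    _ ≤ 2 ^ M * (M.factorial * A * B ^ M * s ^ M * D) := by
        have : (2 : ℝ) ^ i ≤ 2 ^ M := pow_le_pow_right₀ (by norm_num) hi
        have : 0 ≤ s := by linarith
        gcongr
    _ = _ := by ring

/-- If `φ` has order `M` on `K`, then `w ^ (M + 1) f` may be cut off to `|w| ≤ 2 / s` without
changing the value of `φ`. The cut-off function has derivatives up to order `M` of size `O(1 / s)`,
and `s` is arbitrary. -/
theorem exists_mulOp_pow_eq_zero {U : Opens sl2} {E : Type*} [AddCommGroup E] [Module ℝ E]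
    [TopologicalSpace E] [IsTopologicalAddGroup E] [ContinuousSMul ℝ E] [T2Space E]
    [FiniteDimensional ℝ E] (φ : 𝓓'(U, E)) {w : sl2 → ℝ}
    (hw : ContDiff ℝ ((⊤ : ℕ∞) : WithTop ℕ∞) w)
    (hφ : ∀ f : 𝓓(U, ℝ), (∀ P ∈ tsupport f, w P ≠ 0) → φ f = 0)
    {K : Compacts sl2} (hK : (K : Set sl2) ⊆ U) :
    ∃ N, onCompact hK φ ∘ₗ (mulOp K w fun _ _ => hw.contDiffAt) ^ N = 0 := by
  -- `E` carries only a topology; coordinates supply the norm needed for estimates.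
  let e : E ≃L[ℝ] (Fin (Module.finrank ℝ E) → ℝ) :=
    ContinuousLinearEquiv.ofFinrankEq (by simp)
  let ψ : 𝓓_{K}(sl2, ℝ) →L[ℝ] (Fin (Module.finrank ℝ E) → ℝ) :=
    ⟨e.toLinearMap ∘ₗ onCompact hK φ, e.continuous.comp
      ((ContinuousLinearMap.continuous φ).comp (TestFunction.continuous_ofSupportedIn hK))⟩
  obtain ⟨M, C, hC0, hC⟩ := exists_order_bound ψ
  refine ⟨M + 1, LinearMap.ext fun f => e.injective ?_⟩
  rw [LinearMap.zero_apply, map_zero]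
  change ψ _ = 0
  let χ : ContDiffBump (0 : ℝ) := ⟨1, 2, one_pos, one_lt_two⟩
  let η : ℝ → ℝ := fun t => t ^ (M + 1) * χ t
  have hη : ContDiff ℝ ((⊤ : ℕ∞) : WithTop ℕ∞) η := (contDiff_id.pow _).mul χ.contDiff
  have hηc : HasCompactSupport η := χ.hasCompactSupport.mul_left
  have hle : ∀ j : ℕ, ((j : ℕ) : WithTop ℕ∞) ≤ ((⊤ : ℕ∞) : WithTop ℕ∞) := fun j =>
    WithTop.coe_le_coe.mpr le_top
  obtain ⟨A, -, hA⟩ := exists_uniform_bound (F := fun i t => ‖iteratedFDeriv ℝ i η t‖) M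
    fun i _ => (hη.continuous_iteratedFDeriv (hle i)).bounded_above_of_compact_support
      (hηc.iteratedFDeriv i)
      |>.imp fun C hC t => hC t
  obtain ⟨B, hB1, hB⟩ := exists_uniform_bound
    (F := fun i (P : K) => ‖iteratedFDeriv ℝ i w P‖) M fun i _ => by
      obtain ⟨C, hC⟩ := K.isCompact.exists_bound_of_continuousOn
        (hw.continuous_iteratedFDeriv (hle i)).continuousOn
      exact ⟨C, fun P => hC P P.2⟩
  obtain ⟨D, hD1, hD⟩ := exists_uniform_bound
    (F := fun i P => ‖iteratedFDeriv ℝ i f P‖) M fun i _ =>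
      (f.contDiff.continuous_iteratedFDeriv (hle i)).bounded_above_of_compact_support
        (f.hasCompactSupport.iteratedFDeriv i)
  set m := mulOp K w fun _ _ => hw.contDiffAt with hm
  have key : ∀ s : ℝ, 1 ≤ s →
      s * ‖ψ ((m ^ (M + 1)) f)‖ ≤ C * (2 ^ M * (M.factorial * A * B ^ M) * D) := by
    intro s hs
    have hs0 : 0 < s := by linarith
    let g : 𝓓_{K}(sl2, ℝ) :=
      mulOp K (fun Q => η (s * w Q)) (fun _ _ => (hη.comp (contDiff_const.mul hw)).contDiffAt) f
    -- The cut-off is `1` where `|s w| ≤ 1`, so the difference is supported in `|s w| ≥ 1`, away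
    -- from the zeros of `w`.
    have hg : ψ (s ^ (M + 1) • (m ^ (M + 1)) f) = ψ g := by
      rw [← sub_eq_zero, ← map_sub]
      change e (onCompact hK φ (s ^ (M + 1) • (m ^ (M + 1)) f - g)) = 0
      rw [onCompact_apply, hφ, map_zero]
      intro P hP
      have hcl : IsClosed {P | 1 ≤ |s * w P|} :=
        isClosed_le continuous_const (continuous_const.mul hw.continuous).abs
      have hsub : tsupport (TestFunction.ofSupportedIn (n := ⊤) hK
          (s ^ (M + 1) • (m ^ (M + 1)) f - g)) ⊆ {P | 1 ≤ |s * w P|} := by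
        refine closure_minimal (fun Q hQ => ?_) hcl
        by_contra hlt
        refine hQ ?_
        have hχ : χ (s * w Q) = 1 := by
          refine χ.one_of_mem_closedBall ?_
          rw [Set.mem_ofPred_eq, not_le] at hlt
          simpa [χ] using hlt.le
        change s ^ (M + 1) * ((m ^ (M + 1)) f Q) - (s * w Q) ^ (M + 1) * χ (s * w Q) * f Q = 0
        rw [hm, mulOp_pow, hχ]
        ring
      intro h0
      have := hsub hP
      rw [Set.mem_ofPred_eq, h0, mul_zero, abs_zero] at this
      linarith
    have hb := hC g ((2 ^ M * (M.factorial * A * B ^ M) * D) * s ^ M)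
      (by
        have hA0 : 0 ≤ A := (norm_nonneg _).trans (hA 0 (Nat.zero_le _) 0)
        positivity)
      (fun i hi P hP => iteratedFDeriv_cutoff_le hη hw f.contDiff hA
        (fun j hj => hB j hj ⟨P, hP⟩) hB1 (fun j hj => hD j hj P) hs hi)
    rw [← hg, map_smul, norm_smul, Real.norm_of_nonneg (by positivity), pow_succ] at hb
    have hsM : 0 < s ^ M := by positivity
    refine le_of_mul_le_mul_left ?_ hsM
    calc s ^ M * (s * ‖ψ ((m ^ (M + 1)) f)‖) = s ^ M * s * ‖ψ ((m ^ (M + 1)) f)‖ := by ring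
      _ ≤ _ := hb
      _ = _ := by ring
  by_contra hne
  have hpos : 0 < ‖ψ ((m ^ (M + 1)) f)‖ := norm_pos_iff.mpr hne
  set R := C * (2 ^ M * (M.factorial * A * B ^ M) * D) with hR
  have h1 := key (max 1 ((R + 1) / ‖ψ ((m ^ (M + 1)) f)‖)) (le_max_left _ _)
  have h2 : (R + 1) / ‖ψ ((m ^ (M + 1)) f)‖ * ‖ψ ((m ^ (M + 1)) f)‖ ≤ R :=
    (mul_le_mul_of_nonneg_right (le_max_right _ _) hpos.le).trans h1
  rw [div_mul_cancel₀ _ hpos.ne'] at h2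
  linarith

/-! ### Irreducible representations of `𝔰𝔩(2, ℝ)` -/

theorem isSl2Triple : IsSl2Triple H X Y where
  h_ne_zero := by
    intro h
    have : mat H 0 0 = 0 := by rw [h]; rfl
    simp [H, mat_ofCoords] at this
  lie_e_f := by
    apply mat_injective
    ext i j
    fin_cases i <;> fin_cases j <;>
      simp [mat_lie, H, X, Y, mat_ofCoords]
  lie_h_e_nsmul := by
    apply mat_injective
    rw [map_nsmul]
    ext i j
    fin_cases i <;> fin_cases j <;>
      simp [mat_lie, H, X, mat_ofCoords]
    norm_num
  lie_h_f_nsmul := by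
    apply mat_injective
    rw [map_neg, map_nsmul]
    ext i j
    fin_cases i <;> fin_cases j <;>
      simp [mat_lie, H, Y, mat_ofCoords]
    norm_num

section LinearAlgebra

variable {V : Type*} [AddCommGroup V] [Module ℝ V] [FiniteDimensional ℝ V]

/-- The powers of `y` that do not vanish are eigenvectors of `ad h` with distinct eigenvalues `k c`,
so only finitely many are nonzero. -/
theorem isNilpotent_of_commutator {h y : Module.End ℝ V} {c : ℝ} (hc : c ≠ 0)
    (e : h * y - y * h = c • y) : IsNilpotent y := by
  by_contra hy
  have hy' : ∀ k : ℕ, y ^ k ≠ 0 := fun k hk => hy ⟨k, hk⟩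
  have hk : ∀ k : ℕ, h * y ^ k - y ^ k * h = (k * c) • y ^ k := by
    intro k
    induction k with
    | zero => simp
    | succ k ih =>
      have : h * y ^ (k + 1) - y ^ (k + 1) * h =
          (h * y ^ k - y ^ k * h) * y + y ^ k * (h * y - y * h) := by
        rw [pow_succ]; noncomm_ring
      rw [this, ih, e, smul_mul_assoc, mul_smul_comm, ← pow_succ]
      push_cast
      module
  have hli := Module.End.eigenvectors_linearIndependent'
    (LinearMap.mulLeft ℝ h - LinearMap.mulRight ℝ h) (fun k : ℕ => (k : ℝ) * c)
    (fun a b hab => by simpa [hc] using hab) (fun k => y ^ k)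
    (fun k => ⟨Module.End.mem_eigenspace_iff.mpr (hk k), hy' k⟩)
  exact (not_finite_iff_infinite.mpr (inferInstance : Infinite ℕ)) hli.finite

variable [LieRingModule sl2 V] [LieModule ℝ sl2 V]

theorem isNilpotent_toEnd_X : IsNilpotent (LieModule.toEnd ℝ sl2 V X) := by
  refine isNilpotent_of_commutator (h := LieModule.toEnd ℝ sl2 V H) (c := 2) two_ne_zero ?_
  ext u
  change ⁅H, ⁅X, u⁆⁆ - ⁅X, ⁅H, u⁆⁆ = (2 : ℝ) • ⁅X, u⁆
  rw [← lie_lie, isSl2Triple.lie_h_e_smul ℝ, smul_lie]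

theorem isNilpotent_toEnd_Y : IsNilpotent (LieModule.toEnd ℝ sl2 V Y) := by
  refine isNilpotent_of_commutator (h := LieModule.toEnd ℝ sl2 V H) (c := -2) (by norm_num) ?_
  ext u
  change ⁅H, ⁅Y, u⁆⁆ - ⁅Y, ⁅H, u⁆⁆ = (-2 : ℝ) • ⁅Y, u⁆
  rw [← lie_lie, isSl2Triple.lie_lie_smul_f ℝ, ← neg_smul, smul_lie]

/-- Stated without assuming that `v` is a weight vector, because it serves to produce a real
eigenvalue of `H`. -/
theorem lie_X_pow_Y {v : V} (hv : ⁅X, v⁆ = 0) (k : ℕ) :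
    ⁅X, (LieModule.toEnd ℝ sl2 V Y ^ (k + 1)) v⁆ =
      (k + 1 : ℝ) • (LieModule.toEnd ℝ sl2 V Y ^ k) (⁅H, v⁆ - (k : ℝ) • v) := by
  have hH : ∀ k : ℕ, ⁅H, (LieModule.toEnd ℝ sl2 V Y ^ k) v⁆ =
      (LieModule.toEnd ℝ sl2 V Y ^ k) (⁅H, v⁆ - (2 * k : ℝ) • v) := by
    intro k
    induction k with
    | zero => simp
    | succ k ih =>
      rw [pow_succ', Module.End.mul_apply, LieModule.toEnd_apply_apply, leibniz_lie, ih,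
        isSl2Triple.lie_lie_smul_f ℝ, Module.End.mul_apply, LieModule.toEnd_apply_apply]
      simp only [map_sub, map_smul, lie_sub, lie_smul, neg_lie, smul_lie]
      push_cast
      module
  induction k with
  | zero =>
    simp [leibniz_lie X Y v, isSl2Triple.lie_e_f, hv]
  | succ k ih =>
    rw [pow_succ', Module.End.mul_apply, LieModule.toEnd_apply_apply, leibniz_lie, ih,
      isSl2Triple.lie_e_f, hH, pow_succ' _ k, Module.End.mul_apply, LieModule.toEnd_apply_apply]
    simp only [map_sub, map_smul, lie_sub, lie_smul, Module.End.mul_apply,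
      LieModule.toEnd_apply_apply]
    push_cast
    module

/-- Over `ℝ` an eigenvector of `H` on `ker X` has to be found by hand. If `k` is the largest
exponent with `Y ^ k ≠ 0` on `ker X`, then `lie_X_pow_Y` gives `Y ^ k (H - k) = 0` on `ker X`. Hence
`H - k` is not surjective there, and so not injective. -/
theorem exists_primitiveVector [Nontrivial V] :
    ∃ (v : V) (μ : ℝ), isSl2Triple.HasPrimitiveVectorWith v μ := by
  set y := LieModule.toEnd ℝ sl2 V Y
  have hker : LinearMap.ker (LieModule.toEnd ℝ sl2 V X) ≠ ⊥ := by
    intro h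
    obtain ⟨k, hk⟩ := isNilpotent_toEnd_X (V := V)
    have hinj : Function.Injective ((LieModule.toEnd ℝ sl2 V X) ^ k) := by
      rw [Module.End.coe_pow]
      exact (LinearMap.ker_eq_bot.mp h).iterate k
    obtain ⟨v, hv⟩ := exists_ne (0 : V)
    exact hv (hinj (by rw [hk]; rfl))
  obtain ⟨v₁, hv₁, hv₁0⟩ := Submodule.exists_mem_ne_zero_of_ne_bot hker
  have hex : ∃ k : ℕ, ∀ v ∈ LinearMap.ker (LieModule.toEnd ℝ sl2 V X), (y ^ k) v = 0 := by
    obtain ⟨k, hk⟩ := isNilpotent_toEnd_Y (V := V)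
    exact ⟨k, fun v _ => by rw [hk]; rfl⟩
  classical
  obtain ⟨k, hk, hk'⟩ : ∃ k : ℕ,
      (∃ v ∈ LinearMap.ker (LieModule.toEnd ℝ sl2 V X), (y ^ k) v ≠ 0) ∧
      ∀ v ∈ LinearMap.ker (LieModule.toEnd ℝ sl2 V X), (y ^ (k + 1)) v = 0 := by
    have h0 : Nat.find hex ≠ 0 := by
      intro h0
      have := Nat.find_spec hex v₁ hv₁
      rw [h0, pow_zero] at this
      exact hv₁0 this
    refine ⟨Nat.find hex - 1, ?_, ?_⟩
    · have := Nat.find_min hex (m := Nat.find hex - 1) (by omega)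
      push Not at this
      exact this
    · rw [Nat.sub_add_cancel (Nat.pos_of_ne_zero h0)]
      exact Nat.find_spec hex
  have hg : ∀ v ∈ LinearMap.ker (LieModule.toEnd ℝ sl2 V X),
      (LieModule.toEnd ℝ sl2 V H - (k : ℝ) • 1) v ∈ LinearMap.ker (LieModule.toEnd ℝ sl2 V X) := by
    intro v hv
    rw [LinearMap.mem_ker, LieModule.toEnd_apply_apply] at hv ⊢
    have : ⁅X, ⁅H, v⁆⁆ = 0 := by
      rw [leibniz_lie X H v, hv, lie_zero, add_zero, ← lie_skew, isSl2Triple.lie_h_e_smul ℝ,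
        neg_lie, smul_lie, hv, smul_zero, neg_zero]
    simp [this, hv, lie_sub]
  let g := (LieModule.toEnd ℝ sl2 V H - (k : ℝ) • 1).restrict hg
  have hns : ¬ Function.Surjective g := by
    intro hs
    obtain ⟨v, hv, hv0⟩ := hk
    obtain ⟨⟨u, hu⟩, huv⟩ := hs ⟨v, hv⟩
    have h1 := lie_X_pow_Y (LinearMap.mem_ker.mp hu) k
    rw [hk' u hu, lie_zero] at h1
    have h2 := (smul_eq_zero.mp h1.symm).resolve_left (by positivity)
    have h3 : ⁅H, u⁆ - (k : ℝ) • u = v := congrArg Subtype.val huv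
    rw [h3] at h2
    exact hv0 h2
  rw [← LinearMap.injective_iff_surjective, ← LinearMap.ker_eq_bot] at hns
  obtain ⟨⟨v, hv⟩, hvg, hv0⟩ := Submodule.exists_mem_ne_zero_of_ne_bot hns
  refine ⟨v, k, fun h => hv0 (Subtype.ext h), ?_, hv⟩
  have : ⁅H, v⁆ - (k : ℝ) • v = 0 := congrArg Subtype.val (LinearMap.mem_ker.mp hvg)
  exact sub_eq_zero.mp this

theorem linearIndependent_pow_Y {v : V} {n : ℕ}
    (P : isSl2Triple.HasPrimitiveVectorWith v (n : ℝ)) :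
    LinearIndependent ℝ fun j : Fin (n + 1) => (LieModule.toEnd ℝ sl2 V Y ^ (j : ℕ)) v := by
  refine Module.End.eigenvectors_linearIndependent' (LieModule.toEnd ℝ sl2 V H)
    (fun j : Fin (n + 1) => (n : ℝ) - 2 * (j : ℕ)) (fun i j hij => ?_) _ fun j => ⟨?_, ?_⟩
  · have : ((i : ℕ) : ℝ) = (j : ℕ) := by
      simp only at hij
      linarith
    exact Fin.ext (by exact_mod_cast this)
  · exact Module.End.mem_eigenspace_iff.mpr (P.lie_h_pow_toEnd_f j)
  · exact P.pow_toEnd_f_ne_zero_of_eq_nat rfl (Nat.lt_succ_iff.mp j.2)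

theorem span_pow_Y [LieModule.IsIrreducible ℝ sl2 V] {v : V} {n : ℕ}
    (P : isSl2Triple.HasPrimitiveVectorWith v (n : ℝ)) :
    Submodule.span ℝ (Set.range fun j : Fin (n + 1) =>
      (LieModule.toEnd ℝ sl2 V Y ^ (j : ℕ)) v) = ⊤ := by
  set S := Submodule.span ℝ (Set.range fun j : Fin (n + 1) =>
      (LieModule.toEnd ℝ sl2 V Y ^ (j : ℕ)) v) with hS
  have hmem : ∀ k : ℕ, (LieModule.toEnd ℝ sl2 V Y ^ k) v ∈ S := by
    intro k
    rcases lt_or_ge k (n + 1) with hk | hk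
    · exact Submodule.subset_span ⟨⟨k, hk⟩, rfl⟩
    · obtain ⟨l, rfl⟩ := Nat.exists_eq_add_of_le' hk
      rw [pow_add, Module.End.mul_apply, P.pow_toEnd_f_eq_zero_of_eq_nat rfl, map_zero]
      exact S.zero_mem
  have hstab : ∀ Z : sl2, (∀ k : ℕ, ⁅Z, (LieModule.toEnd ℝ sl2 V Y ^ k) v⁆ ∈ S) →
      ∀ u ∈ S, ⁅Z, u⁆ ∈ S := by
    intro Z hZ u hu
    have : S ≤ S.comap (LieModule.toEnd ℝ sl2 V Z) := by
      rw [hS, Submodule.span_le]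
      rintro _ ⟨j, rfl⟩
      exact hZ j
    exact this hu
  have hH := hstab H fun k => by
    rw [P.lie_h_pow_toEnd_f]
    exact S.smul_mem _ (hmem k)
  have hX := hstab X fun k => by
    rcases k with _ | k
    · rw [pow_zero, Module.End.one_apply, P.lie_e]
      exact S.zero_mem
    · rw [P.lie_e_pow_succ_toEnd_f]
      exact S.smul_mem _ (hmem k)
  have hY := hstab Y fun k => by
    rw [P.lie_f_pow_toEnd_f]
    exact hmem (k + 1)
  let N : LieSubmodule ℝ sl2 V :=
    { S with
      lie_mem := fun {Z u} hu => by
        rw [eq_combination Z]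
        simp only [add_lie, smul_lie]
        exact S.add_mem (S.add_mem (S.smul_mem _ (hH u hu)) (S.smul_mem _ (hX u hu)))
          (S.smul_mem _ (hY u hu)) }
  have hN : N ≠ ⊥ := by
    intro h
    have : v ∈ N := hmem 0
    rw [h, LieSubmodule.mem_bot] at this
    exact P.ne_zero this
  have hT : N = ⊤ := (IsSimpleOrder.eq_bot_or_eq_top N).resolve_left hN
  rw [eq_top_iff]
  intro u _
  have : u ∈ N := by rw [hT]; exact LieSubmodule.mem_top u
  exact this

theorem finrank_eq_of_primitive [LieModule.IsIrreducible ℝ sl2 V] {v : V} {n : ℕ}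
    (P : isSl2Triple.HasPrimitiveVectorWith v (n : ℝ)) : Module.finrank ℝ V = n + 1 := by
  have h := finrank_span_eq_card (linearIndependent_pow_Y P)
  rw [span_pow_Y P, finrank_top, Fintype.card_fin] at h
  exact h

theorem exists_primitive_of_finrank [LieModule.IsIrreducible ℝ sl2 V] {n : ℕ}
    (hV : Module.finrank ℝ V = n + 1) :
    ∃ v : V, isSl2Triple.HasPrimitiveVectorWith v (n : ℝ) := by
  have : Nontrivial V := Module.nontrivial_of_finrank_pos (R := ℝ) (by omega)
  obtain ⟨v, μ, P⟩ := exists_primitiveVector (V := V)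
  obtain ⟨m, rfl⟩ := P.exists_nat
  have h := finrank_eq_of_primitive P
  have : m = n := by omega
  exact ⟨v, this ▸ P⟩

/-- The basis of weight vectors `v, Y v, Y² v, …`. -/
def weightBasis {v : V} {n : ℕ} (hV : Module.finrank ℝ V = n + 1)
    (P : isSl2Triple.HasPrimitiveVectorWith v (n : ℝ)) : Module.Basis (Fin (n + 1)) ℝ V :=
  basisOfLinearIndependentOfCardEqFinrank (linearIndependent_pow_Y P) (by simp [hV])

theorem weightBasis_apply {v : V} {n : ℕ} (hV : Module.finrank ℝ V = n + 1)
    (P : isSl2Triple.HasPrimitiveVectorWith v (n : ℝ)) (j : Fin (n + 1)) :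
    weightBasis hV P j = (LieModule.toEnd ℝ sl2 V Y ^ (j : ℕ)) v := by
  simp [weightBasis]

theorem coord_zero_lie_Y {v : V} {n : ℕ} (hV : Module.finrank ℝ V = n + 1)
    (P : isSl2Triple.HasPrimitiveVectorWith v (n : ℝ)) (u : V) :
    (weightBasis hV P).coord 0 ⁅Y, u⁆ = 0 := by
  have : (weightBasis hV P).coord 0 ∘ₗ LieModule.toEnd ℝ sl2 V Y = 0 := by
    refine (weightBasis hV P).ext fun j => ?_
    rw [LinearMap.comp_apply, LieModule.toEnd_apply_apply, weightBasis_apply,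
      P.lie_f_pow_toEnd_f, LinearMap.zero_apply]
    rcases eq_or_lt_of_le (Nat.lt_succ_iff.mp j.2) with hj | hj
    · rw [hj, P.pow_toEnd_f_eq_zero_of_eq_nat rfl, map_zero]
    · rw [← weightBasis_apply hV P ⟨j + 1, by omega⟩, Module.Basis.coord_apply,
        Module.Basis.repr_self, Finsupp.single_apply, if_neg]
      intro h
      simpa using congrArg Fin.val h
  exact LinearMap.congr_fun this u

theorem coord_zero_lie_H {v : V} {n : ℕ} (hV : Module.finrank ℝ V = n + 1)
    (P : isSl2Triple.HasPrimitiveVectorWith v (n : ℝ)) (u : V) :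
    (weightBasis hV P).coord 0 ⁅H, u⁆ = n * (weightBasis hV P).coord 0 u := by
  have : (weightBasis hV P).coord 0 ∘ₗ LieModule.toEnd ℝ sl2 V H =
      (n : ℝ) • (weightBasis hV P).coord 0 := by
    refine (weightBasis hV P).ext fun j => ?_
    rw [LinearMap.comp_apply, LieModule.toEnd_apply_apply, weightBasis_apply,
      P.lie_h_pow_toEnd_f, ← weightBasis_apply hV P j, LinearMap.smul_apply, map_smul,
      Module.Basis.coord_apply, Module.Basis.repr_self, Finsupp.single_apply]
    split_ifs with h
    · simp [h]
    · simp
  exact LinearMap.congr_fun this u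

theorem coord_lie_X {v : V} {n : ℕ} (hV : Module.finrank ℝ V = n + 1)
    (P : isSl2Triple.HasPrimitiveVectorWith v (n : ℝ)) (j : ℕ) (hj : j < n) (u : V) :
    (weightBasis hV P).coord ⟨j, by omega⟩ ⁅X, u⁆ =
      ((j + 1) * ((n : ℝ) - j)) * (weightBasis hV P).coord ⟨j + 1, by omega⟩ u := by
  have : (weightBasis hV P).coord ⟨j, by omega⟩ ∘ₗ LieModule.toEnd ℝ sl2 V X =
      ((j + 1) * ((n : ℝ) - j)) • (weightBasis hV P).coord ⟨j + 1, by omega⟩ := by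
    refine (weightBasis hV P).ext fun k => ?_
    rw [LinearMap.comp_apply, LieModule.toEnd_apply_apply, LinearMap.smul_apply,
      Module.Basis.coord_apply, Module.Basis.coord_apply, Module.Basis.repr_self,
      weightBasis_apply]
    obtain ⟨k, hk⟩ := k
    rcases k with _ | k
    · simp [P.lie_e]
    · rw [P.lie_e_pow_succ_toEnd_f, ← weightBasis_apply hV P ⟨k, by omega⟩, map_smul,
        Module.Basis.repr_self]
      simp only [Finsupp.smul_apply, Finsupp.single_apply, Fin.mk.injEq, add_left_inj]
      split_ifs with h
      · rw [h]
      · simp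
  exact LinearMap.congr_fun this u

/-- By `coord_lie_X` the kernel of `X` is the line spanned by a vector of weight `n`. -/
theorem primitive_of_lie_X [LieModule.IsIrreducible ℝ sl2 V] {n : ℕ}
    (hV : Module.finrank ℝ V = n + 1) {v : V} (hv : v ≠ 0) (hX : ⁅X, v⁆ = 0) :
    isSl2Triple.HasPrimitiveVectorWith v (n : ℝ) := by
  obtain ⟨w, P⟩ := exists_primitive_of_finrank hV
  set b := weightBasis hV P with hb
  have hc : ∀ j : Fin (n + 1), j ≠ 0 → b.repr v j = 0 := by
    rintro ⟨j, hj⟩ h0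
    obtain ⟨k, rfl⟩ : ∃ k, j = k + 1 :=
      Nat.exists_eq_succ_of_ne_zero fun h => h0 (Fin.ext h)
    have h1 := coord_lie_X hV P k (by omega) v
    rw [hX, map_zero] at h1
    have hkn : (k : ℝ) < n := by exact_mod_cast (by omega : k < n)
    exact (mul_eq_zero.mp h1.symm).resolve_left
      (mul_ne_zero (by positivity) (sub_ne_zero.mpr hkn.ne'))
  have hv' : v = b.repr v 0 • w := by
    conv_lhs => rw [← b.sum_repr v]
    rw [Finset.sum_eq_single 0 (fun j _ hj => by rw [hc j hj, zero_smul]) (by simp), hb,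
      weightBasis_apply]
    simp
  refine ⟨hv, ?_, hX⟩
  rw [hv', lie_smul, P.lie_h, smul_comm]

end LinearAlgebra

/-- A linear map to a space with trivial action which is killed by `Y`, of weight `n`, and
generates all linear functionals. -/
structure IsLowestMap (n : ℕ) {E W : Type*} [AddCommGroup E] [Module ℝ E] [LieRingModule sl2 E]
    [LieModule ℝ sl2 E] [AddCommGroup W] [Module ℝ W] (Λ : E →ₗ[ℝ] W) : Prop where
  lie_Y : ∀ e, Λ ⁅Y, e⁆ = 0
  lie_H : ∀ e, Λ ⁅H, e⁆ = (n : ℝ) • Λ e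
  eq_zero : ∀ e, (∀ j : ℕ, Λ ((LieModule.toEnd ℝ sl2 E X ^ j) e) = 0) → e = 0

/-! ### The functional reading off the highest weight coefficient -/

section Lowest

variable {V : Type*} [AddCommGroup V] [Module ℝ V] [FiniteDimensional ℝ V]
  [LieRingModule sl2 V] [LieModule ℝ sl2 V]

theorem exists_coord_pow_X {v : V} {n : ℕ} (hV : Module.finrank ℝ V = n + 1)
    (P : isSl2Triple.HasPrimitiveVectorWith v (n : ℝ)) (j : ℕ) (hj : j < n + 1) :
    ∃ c : ℝ, c ≠ 0 ∧ ∀ u : V, (weightBasis hV P).coord 0 ((LieModule.toEnd ℝ sl2 V X ^ j) u) =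
      c * (weightBasis hV P).coord ⟨j, hj⟩ u := by
  induction j with
  | zero => exact ⟨1, one_ne_zero, fun u => by simp⟩
  | succ j ih =>
    obtain ⟨c, hc, hcu⟩ := ih (by omega)
    have hjn : (j : ℝ) < n := by exact_mod_cast (by omega : j < n)
    refine ⟨c * ((j + 1) * ((n : ℝ) - j)), mul_ne_zero hc
      (mul_ne_zero (by positivity) (sub_ne_zero.mpr hjn.ne')), fun u => ?_⟩
    rw [pow_succ, Module.End.mul_apply, hcu, LieModule.toEnd_apply_apply,
      coord_lie_X hV P j (by omega), ← mul_assoc]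

theorem isLowestMap_coord {v : V} {n : ℕ} (hV : Module.finrank ℝ V = n + 1)
    (P : isSl2Triple.HasPrimitiveVectorWith v (n : ℝ)) :
    IsLowestMap n ((weightBasis hV P).coord 0) where
  lie_Y := coord_zero_lie_Y hV P
  lie_H := coord_zero_lie_H hV P
  eq_zero e he := by
    refine (weightBasis hV P).ext_elem fun j => ?_
    obtain ⟨c, hc, hcu⟩ := exists_coord_pow_X hV P j j.2
    have := he j
    rw [hcu] at this
    rw [map_zero]
    exact (mul_eq_zero.mp this).resolve_left hc

variable (W : Type*) [AddCommGroup W] [Module ℝ W] [LieRingModule sl2 W] [LieModule ℝ sl2 W]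
  [LieModule.IsTrivial sl2 W]

/-- With trivial action on `W`, the argument for `V` applies to the `W`-valued coordinates in the
weight basis. -/
theorem isLowestMap_tensor {v : V} {n : ℕ} (hV : Module.finrank ℝ V = n + 1)
    (P : isSl2Triple.HasPrimitiveVectorWith v (n : ℝ)) :
    IsLowestMap n ((TensorProduct.rid ℝ W).toLinearMap ∘ₗ
      ((weightBasis hV P).coord 0).lTensor W) := by
  set b := weightBasis hV P with hb
  let Λ : Fin (n + 1) → W ⊗[ℝ] V →ₗ[ℝ] W := fun j =>
    (TensorProduct.rid ℝ W).toLinearMap ∘ₗ (b.coord j).lTensor W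
  have hΛ : ∀ j w u, Λ j (w ⊗ₜ u) = b.coord j u • w := fun j w u => by
    simp only [Λ, LinearMap.comp_apply, LinearMap.lTensor_tmul, LinearEquiv.coe_coe,
      TensorProduct.rid_tmul]
  have hlie : ∀ (Z : sl2) (w : W) (u : V), ⁅Z, w ⊗ₜ[ℝ] u⁆ = w ⊗ₜ[ℝ] ⁅Z, u⁆ := fun Z w u => by
    rw [TensorProduct.LieModule.lie_tmul_right, trivial_lie_zero, TensorProduct.zero_tmul, zero_add]
  change IsLowestMap n (Λ 0)
  refine ⟨fun e => ?_, fun e => ?_, fun e he => ?_⟩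
  · induction e using TensorProduct.induction_on with
    | zero => simp
    | tmul w u => rw [hlie, hΛ, coord_zero_lie_Y, zero_smul]
    | add e e' h h' => rw [lie_add, map_add, h, h', add_zero]
  · induction e using TensorProduct.induction_on with
    | zero => simp
    | tmul w u => rw [hlie, hΛ, hΛ, coord_zero_lie_H, mul_smul]
    | add e e' h h' => rw [lie_add, map_add, h, h', map_add, smul_add]
  · have hpow : ∀ (j : ℕ) (w : W) (u : V), (LieModule.toEnd ℝ sl2 (W ⊗[ℝ] V) X ^ j) (w ⊗ₜ[ℝ] u) =
        w ⊗ₜ[ℝ] (LieModule.toEnd ℝ sl2 V X ^ j) u := by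
      intro j w u
      induction j with
      | zero => rfl
      | succ j ih =>
        rw [pow_succ', Module.End.mul_apply, ih, LieModule.toEnd_apply_apply, hlie, pow_succ',
          Module.End.mul_apply, LieModule.toEnd_apply_apply]
    have hsum : e = ∑ j, Λ j e ⊗ₜ[ℝ] b j := by
      clear he
      induction e using TensorProduct.induction_on with
      | zero => simp
      | tmul w u =>
        conv_lhs => rw [← b.sum_repr u, TensorProduct.tmul_sum]
        refine Finset.sum_congr rfl fun j _ => ?_
        rw [hΛ, TensorProduct.smul_tmul]
        rfl
      | add e e' h h' =>
        conv_lhs => rw [h, h']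
        rw [← Finset.sum_add_distrib]
        refine Finset.sum_congr rfl fun j _ => ?_
        rw [map_add, TensorProduct.add_tmul]
    rw [hsum]
    refine Finset.sum_eq_zero fun j _ => ?_
    obtain ⟨c, hc, hcu⟩ := exists_coord_pow_X hV P j j.2
    have hj : ∀ e, Λ 0 ((LieModule.toEnd ℝ sl2 (W ⊗[ℝ] V) X ^ (j : ℕ)) e) = c • Λ j e := by
      intro e
      induction e using TensorProduct.induction_on with
      | zero => simp
      | tmul w u => rw [hpow, hΛ, hΛ, hcu, mul_smul]
      | add e e' h h' => rw [map_add, map_add, h, h', map_add, smul_add]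
    have := he j
    rw [hj] at this
    rw [(smul_eq_zero.mp this).resolve_left hc, TensorProduct.zero_tmul]

end Lowest

/-! ### The vanishing theorem -/

theorem mat_mul_self (Z : sl2) :
    mat Z * mat Z = (mat Z 0 0 * mat Z 0 0 + mat Z 0 1 * mat Z 1 0) • (1 : Matrix (Fin 2) (Fin 2) ℝ) := by
  have h := trace_mat Z
  rw [Matrix.trace_fin_two] at h
  have h' : mat Z 1 1 = -mat Z 0 0 := by linarith
  ext i j
  fin_cases i <;> fin_cases j <;> simp [Matrix.mul_apply, Fin.sum_univ_two, h'] <;> ring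

theorem mem_nilCone_iff (Z : sl2) :
    Z ∈ nilCone ↔ mat Z 0 0 * mat Z 0 0 + mat Z 0 1 * mat Z 1 0 = 0 := by
  refine ⟨fun ⟨k, hk⟩ => ?_, fun h => ⟨2, by rw [pow_two, mat_mul_self, h, zero_smul]⟩⟩
  have h1 : (mat Z * mat Z) ^ k = 0 := by
    rw [← pow_two, ← pow_mul, mul_comm, pow_mul, hk, zero_pow two_ne_zero]
  rw [mat_mul_self, smul_pow, one_pow] at h1
  have h2 := congrFun (congrFun h1 0) 0
  simp only [Matrix.smul_apply, Matrix.one_apply_eq, smul_eq_mul, mul_one, Matrix.zero_apply] at h2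
  exact eq_zero_of_pow_eq_zero h2

section

variable {T W : Type*} [AddCommGroup T] [Module ℝ T] [AddCommGroup W] [Module ℝ W]

theorem comp_add_pow_eq_zero {u : T →ₗ[ℝ] W} {a b : Module.End ℝ T} (hab : Commute a b) {N M : ℕ}
    (ha : u ∘ₗ a ^ N = 0) (hb : u ∘ₗ b ^ M = 0) : u ∘ₗ (a + b) ^ (N + M) = 0 := by
  rw [hab.add_pow, comp_finsetSum]
  refine Finset.sum_eq_zero fun m hm => comp_mul_eq_zero ?_ _
  rw [Finset.mem_range] at hm
  rcases le_or_gt N m with h | h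
  · obtain ⟨k, rfl⟩ := Nat.exists_eq_add_of_le h
    rw [pow_add, mul_assoc]
    exact comp_mul_eq_zero ha _
  · rw [(hab.pow_pow m (N + M - m)).eq, show N + M - m = M + (N - m) by omega, pow_add b, mul_assoc]
    exact comp_mul_eq_zero hb _

end

/-! ### Invariant functionals and reduction to the radial operator -/

section Invariant

variable {K : Compacts sl2} {E W : Type*} [AddCommGroup E] [Module ℝ E] [LieRingModule sl2 E]
  [LieModule ℝ sl2 E] [AddCommGroup W] [Module ℝ W]

/-- A linear map on test functions supported in `K` which intertwines the action of `𝔤`. -/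
def IsIntertwining (ψ : 𝓓_{K}(sl2, ℝ) →ₗ[ℝ] E) : Prop :=
  ∀ (Z : sl2) (f : 𝓓_{K}(sl2, ℝ)), ψ (lieOp K Z f) = ⁅Z, ψ f⁆

theorem IsIntertwining.pow {ψ : 𝓓_{K}(sl2, ℝ) →ₗ[ℝ] E} (h : IsIntertwining ψ) (Z : sl2) (j : ℕ) :
    ψ ∘ₗ lieOp K Z ^ j = (LieModule.toEnd ℝ sl2 E Z ^ j) ∘ₗ ψ := by
  induction j with
  | zero => rfl
  | succ j ih =>
    ext f
    have h1 : ψ ((lieOp K Z ^ j) (lieOp K Z f)) = (LieModule.toEnd ℝ sl2 E Z ^ j) (ψ (lieOp K Z f)) :=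
      LinearMap.congr_fun ih _
    simp only [LinearMap.comp_apply, pow_succ, Module.End.mul_apply]
    rw [h1, h Z f]
    rfl

theorem IsIntertwining.box {ψ : 𝓓_{K}(sl2, ℝ) →ₗ[ℝ] E} (h : IsIntertwining ψ) (k : ℕ) :
    IsIntertwining (ψ ∘ₗ boxOp K ^ k) := by
  intro Z f
  have hc : boxOp K ^ k * lieOp K Z = lieOp K Z * boxOp K ^ k :=
    Commute.pow_left (boxOp_comm_lieOp K Z) k
  have := LinearMap.congr_fun hc f
  rw [Module.End.mul_apply, Module.End.mul_apply] at this
  rw [LinearMap.comp_apply, this, h Z]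
  rfl

/-- Intertwining turns `Λ (X ^ j (ψ f))` into `Λ (ψ (L_X ^ j f))`, so the single component `Λ ∘ ψ`
controls all the others. -/
theorem IsIntertwining.eq_zero {n : ℕ} {Λ : E →ₗ[ℝ] W} (hΛ : IsLowestMap n Λ)
    {ψ : 𝓓_{K}(sl2, ℝ) →ₗ[ℝ] E} (h : IsIntertwining ψ) (h0 : Λ ∘ₗ ψ = 0) : ψ = 0 := by
  ext f
  refine hΛ.eq_zero _ fun j => ?_
  have h1 := LinearMap.congr_fun (h.pow X j) f
  rw [LinearMap.comp_apply, LinearMap.comp_apply] at h1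
  rw [← h1]
  exact LinearMap.congr_fun h0 _

/-- Multiplication by the inverse of the upper right entry. -/
def invOp (hx : ∀ P ∈ K, mat P 0 1 ≠ 0) : Module.End ℝ 𝓓_{K}(sl2, ℝ) :=
  mulOp K (fun P => (entry 0 1 P)⁻¹) fun P hP => (contDiffAt_entry 0 1 P).inv (hx P hP)

theorem entryOp_mul_invOp (hx : ∀ P ∈ K, mat P 0 1 ≠ 0) : entryOp K 0 1 * invOp hx = 1 := by
  ext f P
  change entry 0 1 P * ((entry 0 1 P)⁻¹ * f P) = f P
  by_cases hP : P ∈ K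
  · rw [← mul_assoc, mul_inv_cancel₀ (show entry 0 1 P ≠ 0 from hx P hP), one_mul]
  · have : f P = 0 := f.zero_on_compl hP
    simp [this]

theorem invOp_mul_entryOp (hx : ∀ P ∈ K, mat P 0 1 ≠ 0) : invOp hx * entryOp K 0 1 = 1 := by
  rw [← entryOp_mul_invOp hx]
  exact mulOp_comm _ _ _ _

/-- The derivative `x⁻¹ ∂_Y` transversal to the cone. -/
def transversalOp (hx : ∀ P ∈ K, mat P 0 1 ≠ 0) : Module.End ℝ 𝓓_{K}(sl2, ℝ) :=
  invOp hx * derivOp K Y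

theorem transversalOp_mul_coneOp (hx : ∀ P ∈ K, mat P 0 1 ≠ 0) :
    transversalOp hx * coneOp K = coneOp K * transversalOp hx + 1 :=
  weyl_cone_comm (weylRelations K) (entryOp_mul_invOp hx) (invOp_mul_entryOp hx)

theorem IsIntertwining.comp_box_eq {n : ℕ} {Λ : E →ₗ[ℝ] W} (hΛ : IsLowestMap n Λ)
    {ψ : 𝓓_{K}(sl2, ℝ) →ₗ[ℝ] E} (h : IsIntertwining ψ) (hx : ∀ P ∈ K, mat P 0 1 ≠ 0) :
    (Λ ∘ₗ ψ) ∘ₗ boxOp K = (Λ ∘ₗ ψ) ∘ₗ radial (n : ℝ) (coneOp K) (transversalOp hx) := by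
  have hY : (Λ ∘ₗ ψ) ∘ₗ (entryOp K 0 1 * derivOp K H -
      (2 : ℝ) • (entryOp K 0 0 * derivOp K Y)) = 0 := by
    ext f
    rw [← lieOp_Y]
    change Λ (ψ (lieOp K Y f)) = 0
    rw [h Y f, hΛ.lie_Y]
  have hH : (Λ ∘ₗ ψ) ∘ₗ ((2 : ℝ) • (entryOp K 1 0 * derivOp K Y) -
      (2 : ℝ) • (entryOp K 0 1 * derivOp K X) - (n : ℝ) • 1) = 0 := by
    ext f
    rw [← lieOp_H]
    change Λ (ψ (lieOp K H f - (n : ℝ) • f)) = 0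
    rw [map_sub, map_sub, h H f, hΛ.lie_H, map_smul, map_smul, sub_self]
  rw [boxOp, box_eq_radial (weylRelations K) (entryOp_mul_invOp hx) (invOp_mul_entryOp hx) (n : ℝ),
    LinearMap.comp_add, LinearMap.comp_add, comp_mul_eq_zero hY, comp_mul_eq_zero hH, zero_add,
    zero_add]
  rfl

theorem IsIntertwining.comp_box_pow {n : ℕ} {Λ : E →ₗ[ℝ] W} (hΛ : IsLowestMap n Λ)
    {ψ : 𝓓_{K}(sl2, ℝ) →ₗ[ℝ] E} (h : IsIntertwining ψ) (hx : ∀ P ∈ K, mat P 0 1 ≠ 0) (k : ℕ) :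
    (Λ ∘ₗ ψ) ∘ₗ boxOp K ^ k = (Λ ∘ₗ ψ) ∘ₗ radial (n : ℝ) (coneOp K) (transversalOp hx) ^ k := by
  induction k with
  | zero => rfl
  | succ k ih =>
    -- The one-step formula is applied to `ψ ∘ □ ^ k`, which is again intertwining; `radial` itself
    -- need not preserve that property.
    have h1 := (h.box k).comp_box_eq hΛ hx
    rw [pow_succ, pow_succ, Module.End.mul_eq_comp, Module.End.mul_eq_comp, ← LinearMap.comp_assoc,
      ← LinearMap.comp_assoc, ← ih]
    exact h1

theorem IsIntertwining.comp_monicValue {n : ℕ} {Λ : E →ₗ[ℝ] W} (hΛ : IsLowestMap n Λ)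
    {ψ : 𝓓_{K}(sl2, ℝ) →ₗ[ℝ] E} (h : IsIntertwining ψ) (hx : ∀ P ∈ K, mat P 0 1 ≠ 0) {r : ℕ}
    (a : Fin r → ℝ) : (Λ ∘ₗ ψ) ∘ₗ monicValue a (boxOp K) =
      (Λ ∘ₗ ψ) ∘ₗ monicValue a (radial (n : ℝ) (coneOp K) (transversalOp hx)) := by
  simp only [monicValue, LinearMap.comp_add, comp_finsetSum, LinearMap.comp_smul,
    h.comp_box_pow hΛ hx]

theorem IsIntertwining.eq_zero_of_entry_ne_zero {n : ℕ} {Λ : E →ₗ[ℝ] W} (hΛ : IsLowestMap n Λ)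
    {ψ : 𝓓_{K}(sl2, ℝ) →ₗ[ℝ] E} (h : IsIntertwining ψ) (hx : ∀ P ∈ K, mat P 0 1 ≠ 0) {N : ℕ}
    (hN : ψ ∘ₗ coneOp K ^ N = 0) {r : ℕ} (a : Fin r → ℝ) (ha : ψ ∘ₗ monicValue a (boxOp K) = 0)
    (hn : Even n ∨ (Odd n ∧ ∃ hr : 0 < r, a ⟨0, hr⟩ ≠ 0)) : ψ = 0 := by
  refine h.eq_zero hΛ ?_
  have hN' : (Λ ∘ₗ ψ) ∘ₗ coneOp K ^ N = 0 := by
    rw [LinearMap.comp_assoc, hN, LinearMap.comp_zero]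
  have ha' : (Λ ∘ₗ ψ) ∘ₗ monicValue a (radial (n : ℝ) (coneOp K) (transversalOp hx)) = 0 := by
    rw [← h.comp_monicValue hΛ hx, LinearMap.comp_assoc, ha, LinearMap.comp_zero]
  rcases hn with hn | ⟨hn, hr, h0⟩
  · exact eq_zero_of_radial_even (transversalOp_mul_coneOp hx) hn hN' a ha'
  · exact eq_zero_of_radial_odd (transversalOp_mul_coneOp hx) hn hN' a hr h0 ha'

end Invariant

/-! ### Powers of coordinates killing a generalized function supported in the cone -/

section Torsion

variable {U : Opens sl2} {E : Type*} [AddCommGroup E] [Module ℝ E] [TopologicalSpace E]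
  [IsTopologicalAddGroup E] [ContinuousSMul ℝ E] [T2Space E] [FiniteDimensional ℝ E]
  {K : Compacts sl2}

theorem IsSupportedInNilCone.coneOp_torsion {φ : 𝓓'(U, E)} (h : IsSupportedInNilCone φ)
    (hK : (K : Set sl2) ⊆ U) : ∃ N, onCompact hK φ ∘ₗ coneOp K ^ N = 0 := by
  have hw : ContDiff ℝ ((⊤ : ℕ∞) : WithTop ℕ∞) fun P : sl2 =>
      entry 0 0 P * entry 0 0 P + entry 0 1 P * entry 1 0 P := by fun_prop
  obtain ⟨N, hN⟩ := exists_mulOp_pow_eq_zero φ hw (fun f hf => h f fun P hP =>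
    ⟨f.tsupport_subset hP, fun hn => hf P hP ((mem_nilCone_iff P).mp hn)⟩) hK
  refine ⟨N, ?_⟩
  have : coneOp K = mulOp K _ fun _ _ => hw.contDiffAt := by
    ext f P
    change entry 0 0 P * (entry 0 0 P * f P) + entry 0 1 P * (entry 1 0 P * f P) =
      (entry 0 0 P * entry 0 0 P + entry 0 1 P * entry 1 0 P) * f P
    ring
  rw [this]
  exact hN

/-- A generalized function which is supported in the cone and vanishes where `x ≠ 0` is killed by
powers of `x` and of `h`. -/
theorem entry_torsion {φ : 𝓓'(U, E)} (h : IsSupportedInNilCone φ)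
    (hx : ∀ (K : Compacts sl2) (hK : (K : Set sl2) ⊆ U), (∀ P ∈ K, mat P 0 1 ≠ 0) →
      onCompact hK φ = 0) (hK : (K : Set sl2) ⊆ U) :
    (∃ M, onCompact hK φ ∘ₗ entryOp K 0 1 ^ M = 0) ∧
      ∃ L, onCompact hK φ ∘ₗ entryOp K 0 0 ^ L = 0 := by
  obtain ⟨N, hN⟩ := h.coneOp_torsion hK
  obtain ⟨M, hM⟩ := exists_mulOp_pow_eq_zero φ (entry 0 1).contDiff (fun f hf => by
    rw [apply_eq_onCompact, hx (supportCompact f) (supportCompact_subset f) hf]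
    rfl) hK
  refine ⟨⟨M, hM⟩, 2 * (N + M), ?_⟩
  have w := weylRelations K
  have hxy : Commute (entryOp K 0 1) (entryOp K 1 0) := w.yx.symm
  have hhx : Commute (entryOp K 0 0) (entryOp K 0 1) := w.xh.symm
  have hhy : Commute (entryOp K 0 0) (entryOp K 1 0) := w.yh.symm
  -- `h² = (h² + xy) - xy` is a sum of commuting operators, each having a power that kills `φ`.
  have e : entryOp K 0 0 ^ (2 * (N + M)) =
      (coneOp K + -(entryOp K 0 1 * entryOp K 1 0)) ^ (N + M) := by
    rw [coneOp, add_neg_cancel_right, pow_mul, pow_two]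
  rw [e]
  refine comp_add_pow_eq_zero ?_ hN ?_
  · refine Commute.neg_right (Commute.add_left ?_ (Commute.refl _))
    exact (hhx.mul_left hhx).mul_right (hhy.mul_left hhy)
  · have e2 : (-(entryOp K 0 1 * entryOp K 1 0)) ^ M =
        entryOp K 0 1 ^ M * ((-1) ^ M * entryOp K 1 0 ^ M) := by
      rw [neg_pow, hxy.mul_pow, ← mul_assoc, ← mul_assoc,
        ((Commute.one_left (entryOp K 0 1 ^ M)).neg_left.pow_left M).eq]
    rw [e2]
    exact comp_mul_eq_zero hM _

end Torsion

/-- The radial descent handles `x ≠ 0`. The remainder is killed by a power of `h`, and the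
noncharacteristic argument removes it, even at the origin. -/
theorem vanishing_of_monic {U : Opens sl2} {E W : Type*} [AddCommGroup E] [Module ℝ E]
    [TopologicalSpace E] [IsTopologicalAddGroup E] [ContinuousSMul ℝ E] [T2Space E]
    [FiniteDimensional ℝ E] [LieRingModule sl2 E] [LieModule ℝ sl2 E] [AddCommGroup W]
    [Module ℝ W] {n : ℕ} {Λ : E →ₗ[ℝ] W} (hΛ : IsLowestMap n Λ) {φ : 𝓓'(U, E)}
    (hinv : IsLocallyInvariant φ) (hsupp : IsSupportedInNilCone φ) {r : ℕ} (a : Fin r → ℝ)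
    (ha : casimir^[r] φ + ∑ k : Fin r, a k • casimir^[(k : ℕ)] φ = 0)
    (hn : Even n ∨ (Odd n ∧ ∃ hr : 0 < r, a ⟨0, hr⟩ ≠ 0)) : φ = 0 := by
  have hmon : ∀ (K : Compacts sl2) (hK : (K : Set sl2) ⊆ U),
      onCompact hK φ ∘ₗ monicValue a (boxOp K) = 0 := fun K hK => by
    rw [← onCompact_monicValue, ha, onCompact_zero]
  have hx : ∀ (K : Compacts sl2) (hK : (K : Set sl2) ⊆ U), (∀ P ∈ K, mat P 0 1 ≠ 0) →
      onCompact hK φ = 0 := fun K hK hx => by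
    obtain ⟨N, hN⟩ := hsupp.coneOp_torsion hK
    exact IsIntertwining.eq_zero_of_entry_ne_zero hΛ (onCompact_invariant hinv hK) hx hN a
      (hmon K hK) hn
  refine eq_zero_of_onCompact fun K hK => ?_
  obtain ⟨-, L, hL⟩ := entry_torsion hsupp hx hK
  have w := weylRelations K
  refine eq_zero_of_noncharacteristic w.ph ?_ hL a (hmon K hK)
  rw [smul_mul_assoc, mul_smul_comm, mul_assoc, w.sh, ← mul_assoc, w.rh, mul_assoc]

/-! ### The moment map -/

theorem mat_moment_zero_zero (p : Fin 2 → ℝ) : mat (moment p) 0 0 = -(p 0 * p 1) / 2 := rfl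

theorem mat_moment_zero_one (p : Fin 2 → ℝ) : mat (moment p) 0 1 = p 0 ^ 2 / 2 := rfl

theorem mat_moment_one_zero (p : Fin 2 → ℝ) : mat (moment p) 1 0 = -(p 1 ^ 2) / 2 := rfl

theorem mat_moment_one_one (p : Fin 2 → ℝ) : mat (moment p) 1 1 = -(-(p 0 * p 1) / 2) := rfl

theorem moment_eq_combination (p : Fin 2 → ℝ) :
    moment p = (-(p 0 * p 1) / 2) • H + (p 0 ^ 2 / 2) • X + (-(p 1 ^ 2) / 2) • Y :=
  eq_combination (moment p)

theorem moment_neg (p : Fin 2 → ℝ) : moment (-p) = moment p := by simp [moment]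

theorem moment_mem_nilCone (p : Fin 2 → ℝ) : moment p ∈ nilCone := by
  rw [mem_nilCone_iff, mat_moment_zero_zero, mat_moment_zero_one, mat_moment_one_zero]
  ring

theorem moment_mem_nilConePos {p : Fin 2 → ℝ} (hp : p ≠ 0) : moment p ∈ nilConePos := by
  refine ⟨moment_mem_nilCone p, ?_⟩
  rw [mat_moment_zero_one, mat_moment_one_zero]
  by_contra! h
  apply hp
  ext i
  fin_cases i <;> simp <;> nlinarith [sq_nonneg (p 0), sq_nonneg (p 1)]

theorem eq_or_eq_neg_of_moment_eq {p q : Fin 2 → ℝ} (h : moment q = moment p) : q = p ∨ q = -p := by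
  have h1 : mat (moment q) 0 0 = mat (moment p) 0 0 := by rw [h]
  have h2 : mat (moment q) 0 1 = mat (moment p) 0 1 := by rw [h]
  have h3 : mat (moment q) 1 0 = mat (moment p) 1 0 := by rw [h]
  rw [mat_moment_zero_zero, mat_moment_zero_zero] at h1
  rw [mat_moment_zero_one, mat_moment_zero_one] at h2
  rw [mat_moment_one_zero, mat_moment_one_zero] at h3
  have e : (q 0 - p 0) * (q 0 + p 0) = 0 := by linear_combination 2 * h2
  have e' : (q 1 - p 1) * (q 1 + p 1) = 0 := by linear_combination -2 * h3
  have e'' : q 0 * q 1 = p 0 * p 1 := by linear_combination -2 * h1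
  rcases mul_eq_zero.mp e with h0 | h0 <;> rcases mul_eq_zero.mp e' with h4 | h4
  · left; ext i; fin_cases i <;> simp <;> linarith
  · have a : q 0 = p 0 := by linarith
    have b : q 1 = -p 1 := by linarith
    rw [a, b] at e''
    have : p 0 * p 1 = 0 := by linarith
    rcases mul_eq_zero.mp this with h5 | h5
    · right; ext i; fin_cases i <;> simp <;> linarith
    · left; ext i; fin_cases i <;> simp <;> linarith
  · have a : q 0 = -p 0 := by linarith
    have b : q 1 = p 1 := by linarith
    rw [a, b] at e''
    have : p 0 * p 1 = 0 := by linarith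
    rcases mul_eq_zero.mp this with h5 | h5
    · left; ext i; fin_cases i <;> simp <;> linarith
    · right; ext i; fin_cases i <;> simp <;> linarith
  · right; ext i; fin_cases i <;> simp <;> linarith

theorem contDiff_moment {m : WithTop ℕ∞} : ContDiff ℝ m moment := by
  rw [funext moment_eq_combination]
  fun_prop

theorem continuous_moment : Continuous moment := contDiff_moment.continuous (n := 0)

/-- The moment map is equivariant. -/
theorem fderiv_moment (p : Fin 2 → ℝ) (Z : sl2) :
    fderiv ℝ moment p ((mat Z).mulVec p) = ⁅Z, moment p⁆ := by
  have h0 : HasFDerivAt (fun p : Fin 2 → ℝ => p 0) (ContinuousLinearMap.proj 0 : (Fin 2 → ℝ) →L[ℝ] ℝ) p := hasFDerivAt_apply 0 p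
  have h1 : HasFDerivAt (fun p : Fin 2 → ℝ => p 1) (ContinuousLinearMap.proj 1 : (Fin 2 → ℝ) →L[ℝ] ℝ) p := hasFDerivAt_apply 1 p
  have hd : HasFDerivAt moment
      (((((-(1 / 2) : ℝ)) • (p 0 • (ContinuousLinearMap.proj 1 : (Fin 2 → ℝ) →L[ℝ] ℝ) + p 1 • (ContinuousLinearMap.proj 0 : (Fin 2 → ℝ) →L[ℝ] ℝ))).smulRight H) + ((p 0) • (ContinuousLinearMap.proj 0 : (Fin 2 → ℝ) →L[ℝ] ℝ)).smulRight X + ((-p 1) • (ContinuousLinearMap.proj 1 : (Fin 2 → ℝ) →L[ℝ] ℝ)).smulRight Y) p := by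
    rw [funext moment_eq_combination]
    refine ((HasFDerivAt.smul_const ?_ H).add (HasFDerivAt.smul_const ?_ X)).add
      (HasFDerivAt.smul_const ?_ Y)
    · refine ((h0.mul h1).const_mul (-(1 / 2) : ℝ)).congr_of_eventuallyEq (.of_forall fun q => ?_)
      simp
      ring
    · refine (((h0.pow 2).const_mul (1 / 2 : ℝ)).congr_of_eventuallyEq (.of_forall fun q => ?_)).congr_fderiv ?_
      · simp; ring
      · ext q; simp; ring
    · refine (((h1.pow 2).const_mul (-(1 / 2) : ℝ)).congr_of_eventuallyEq (.of_forall fun q => ?_)).congr_fderiv ?_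
      · simp; ring
      · ext q; simp; ring
  rw [hd.fderiv]
  have hZ := trace_mat Z
  rw [Matrix.trace_fin_two] at hZ
  have hZ' : mat Z 1 1 = -mat Z 0 0 := by linarith
  rw [eq_combination ⁅Z, moment p⁆]
  simp only [add_apply, ContinuousLinearMap.smulRight_apply, smul_apply, ContinuousLinearMap.proj_apply,
    mat_lie, Matrix.sub_apply, Matrix.mul_apply, Fin.sum_univ_two, Matrix.mulVec, dotProduct, hZ',
    mat_moment_zero_zero, mat_moment_zero_one, mat_moment_one_zero, mat_moment_one_one, smul_eq_mul]
  congr 2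
  · congr 2
    ring
  · congr 1
    ring
  · ring

/-- The entries `x = a² / 2` and `y = -b² / 2` bound `a` and `b`, so `moment` is proper. -/
theorem isCompact_preimage_moment {K : Set sl2} (hK : IsCompact K) : IsCompact (moment ⁻¹' K) := by
  refine Metric.isCompact_of_isClosed_isBounded (hK.isClosed.preimage continuous_moment) ?_
  obtain ⟨A, hA⟩ := hK.exists_bound_of_continuousOn (entry 0 1).continuous.continuousOn
  obtain ⟨B, hB⟩ := hK.exists_bound_of_continuousOn (entry 1 0).continuous.continuousOn
  refine (Metric.isBounded_iff_subset_closedBall 0).mpr ⟨1 + |A| + |B|, fun p hp => ?_⟩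
  have h1 := hA _ hp
  have h2 := hB _ hp
  rw [entry_apply, mat_moment_zero_one, Real.norm_eq_abs, abs_le] at h1
  rw [entry_apply, mat_moment_one_zero, Real.norm_eq_abs, abs_le] at h2
  have hA' := le_abs_self A
  have hB' := le_abs_self B
  have hA0 := abs_nonneg A
  have hB0 := abs_nonneg B
  rw [mem_closedBall_zero_iff, pi_norm_le_iff_of_nonneg (by positivity)]
  intro i
  fin_cases i
  · exact abs_le_of_sq_le_sq (by simp; nlinarith) (by positivity)
  · exact abs_le_of_sq_le_sq (by simp; nlinarith) (by positivity)

/-! ### Sections of the moment map -/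

section Section

variable {U : Opens sl2} {s : sl2 → Fin 2 → ℝ}

theorem dotProduct_self_ne_zero {p : Fin 2 → ℝ} (hp : p ≠ 0) : p ⬝ᵥ p ≠ 0 :=
  fun h => hp (dotProduct_self_eq_zero.mp h)

theorem IsSection.eq_or_eq_neg (hs : IsSection U s) {p : Fin 2 → ℝ} (hp : p ≠ 0)
    (hU : moment p ∈ U) : s (moment p) = p ∨ s (moment p) = -p :=
  eq_or_eq_neg_of_moment_eq (hs.2 _ ⟨hU, moment_mem_nilConePos hp⟩)

theorem IsSection.continuousAt (hs : IsSection U s) {p : Fin 2 → ℝ} (hp : p ≠ 0)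
    (hU : moment p ∈ U) : ContinuousAt (fun q => s (moment q)) p := by
  have h1 : ContinuousWithinAt s ((U : Set sl2) ∩ nilConePos) (moment p) :=
    hs.1 _ ⟨hU, moment_mem_nilConePos hp⟩
  refine ContinuousWithinAt.tendsto h1 |>.comp (tendsto_nhdsWithin_iff.mpr
    ⟨continuous_moment.continuousAt, ?_⟩)
  filter_upwards [(U.isOpen.preimage continuous_moment).mem_nhds hU, isOpen_ne.mem_nhds hp]
    with q hq hq'
  exact ⟨hq, moment_mem_nilConePos hq'⟩

/-- A neighborhood of `0` does not admit a section. -/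
theorem IsSection.zero_notMem (hs : IsSection U s) : moment 0 ∉ U := by
  intro h0
  obtain ⟨ε, hε, hball⟩ := Metric.isOpen_iff.mp (U.isOpen.preimage continuous_moment) 0 h0
  let γ : ℝ → Fin 2 → ℝ := fun θ => ![ε / 2 * Real.cos θ, ε / 2 * Real.sin θ]
  have hγ : Continuous γ := by
    refine continuous_pi fun i => ?_
    fin_cases i <;> simp [γ] <;> fun_prop
  have hγγ : ∀ θ, γ θ ⬝ᵥ γ θ = (ε / 2) ^ 2 := fun θ => by
    have := Real.sin_sq_add_cos_sq θ
    simp only [γ, dotProduct, Fin.sum_univ_two, Matrix.cons_val_zero, Matrix.cons_val_one]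
    linear_combination (ε / 2) ^ 2 * this
  have hγ0 : ∀ θ, γ θ ≠ 0 := fun θ h => by
    have := hγγ θ
    rw [h, dotProduct_zero] at this
    exact (by positivity : (ε / 2) ^ 2 ≠ 0) this.symm
  have hγU : ∀ θ, moment (γ θ) ∈ U := fun θ => hball (by
    rw [mem_ball_zero_iff]
    refine (pi_norm_le_iff_of_nonneg (by positivity : (0 : ℝ) ≤ ε / 2)).mpr (fun i => ?_)
      |>.trans_lt (by linarith)
    have h1 := Real.abs_cos_le_one θ
    have h2 := Real.abs_sin_le_one θ
    have h3 : |ε| = ε := abs_of_pos hε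
    fin_cases i <;> simp [γ, h3] <;> nlinarith)
  have hD : Continuous fun θ => s (moment (γ θ)) ⬝ᵥ γ θ :=
    (continuous_iff_continuousAt.mpr fun θ =>
      ContinuousAt.comp (f := γ) (hs.continuousAt (hγ0 θ) (hγU θ)) hγ.continuousAt).dotProduct hγ
  have hne : ∀ θ, s (moment (γ θ)) ⬝ᵥ γ θ ≠ 0 := fun θ => by
    rcases hs.eq_or_eq_neg (hγ0 θ) (hγU θ) with h | h
    · rw [h]; exact dotProduct_self_ne_zero (hγ0 θ)
    · rw [h, neg_dotProduct]; exact neg_ne_zero.mpr (dotProduct_self_ne_zero (hγ0 θ))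
  -- The scalar product of `s (moment (γ θ))` with `γ θ` is continuous and never zero. Yet it
  -- changes sign along this half circle, whose endpoints have the same image under `moment`.
  have hπ : γ Real.pi = -γ 0 := by
    ext i
    fin_cases i <;> simp [γ]
  have hodd : s (moment (γ Real.pi)) ⬝ᵥ γ Real.pi = -(s (moment (γ 0)) ⬝ᵥ γ 0) := by
    rw [hπ, moment_neg, dotProduct_neg]
  have : (0 : ℝ) ∈ Set.range fun θ => s (moment (γ θ)) ⬝ᵥ γ θ := by
    rcases le_total (s (moment (γ 0)) ⬝ᵥ γ 0) 0 with h | h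
    · exact mem_range_of_exists_le_of_exists_ge hD ⟨0, h⟩ ⟨Real.pi, by rw [hodd]; linarith⟩
    · exact mem_range_of_exists_le_of_exists_ge hD ⟨Real.pi, by rw [hodd]; linarith⟩ ⟨0, h⟩
  obtain ⟨θ, hθ⟩ := this
  exact hne θ hθ

theorem IsSection.ne_zero (hs : IsSection U s) {p : Fin 2 → ℝ} (hU : moment p ∈ U) : p ≠ 0 := by
  rintro rfl
  exact hs.zero_notMem hU

/-- Locally, a section is an inverse of the moment map up to a constant sign. -/
theorem IsSection.eventually_eq (hs : IsSection U s) {p : Fin 2 → ℝ} (hU : moment p ∈ U) :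
    ∃ ε : ℝ, ε ≠ 0 ∧ ∀ᶠ q in nhds p, s (moment q) = ε • q := by
  have hp := hs.ne_zero hU
  have hD : ContinuousAt (fun q => s (moment q) ⬝ᵥ q) p := by
    have h := hs.continuousAt hp hU
    simp only [dotProduct]
    exact tendsto_finsetSum _ fun i _ => ((continuous_apply i).continuousAt.comp h).mul (continuous_apply i).continuousAt
  have hnear : ∀ᶠ q in nhds p, q ≠ 0 ∧ moment q ∈ U := Filter.Eventually.and (isOpen_ne.mem_nhds hp)
    ((U.isOpen.preimage continuous_moment).mem_nhds hU)
  have hpos : ∀ {q : Fin 2 → ℝ}, 0 ≤ q ⬝ᵥ q := fun {q} => by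
    rw [dotProduct, Fin.sum_univ_two]
    exact add_nonneg (mul_self_nonneg _) (mul_self_nonneg _)
  rcases hs.eq_or_eq_neg hp hU with h | h
  · have h1 : 0 < s (moment p) ⬝ᵥ p := by
      rw [h]; exact lt_of_le_of_ne hpos (dotProduct_self_ne_zero hp).symm
    refine ⟨1, one_ne_zero, ?_⟩
    filter_upwards [hnear, hD.eventually (lt_mem_nhds h1)] with q hq hq'
    rcases hs.eq_or_eq_neg hq.1 hq.2 with h' | h'
    · rw [h', one_smul]
    · rw [h', neg_dotProduct] at hq'
      linarith [hpos (q := q)]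
  · have h1 : s (moment p) ⬝ᵥ p < 0 := by
      rw [h, neg_dotProduct]
      exact neg_neg_of_pos (lt_of_le_of_ne hpos (dotProduct_self_ne_zero hp).symm)
    refine ⟨-1, by norm_num, ?_⟩
    filter_upwards [hnear, hD.eventually (gt_mem_nhds h1)] with q hq hq'
    rcases hs.eq_or_eq_neg hq.1 hq.2 with h' | h'
    · rw [h'] at hq'
      linarith [hpos (q := q)]
    · rw [h', neg_one_smul]

end Section

/-! ### The generalized function of a section -/

/-- A linear vector field of trace zero has divergence zero. -/
theorem integral_fderiv_mulVec_eq_zero {V : Type*} [NormedAddCommGroup V] [NormedSpace ℝ V]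
    {F : (Fin 2 → ℝ) → V} (hF : ContDiff ℝ 1 F) (hc : HasCompactSupport F)
    {A : Matrix (Fin 2) (Fin 2) ℝ} (hA : A.trace = 0) :
    ∫ p, fderiv ℝ F p (A.mulVec p) = 0 := by
  have hd : Continuous (fderiv ℝ F) := hF.continuous_fderiv (by simp)
  have hdc : HasCompactSupport (fderiv ℝ F) := hc.fderiv (𝕜 := ℝ)
  have hg : ∀ i, ContDiff ℝ 1 fun p : Fin 2 → ℝ => A.mulVec p i := fun i => by
    simp only [Matrix.mulVec, dotProduct]
    fun_prop
  have hgd : ∀ i (p : Fin 2 → ℝ), fderiv ℝ (fun p : Fin 2 → ℝ => A.mulVec p i) p (Pi.single i 1) = A i i := by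
    intro i p
    have := ((LinearMap.toContinuousLinearMap (Matrix.mulVecLin A)).hasFDerivAt (x := p))
    have h2 := (hasFDerivAt_pi'.mp this i).fderiv
    have h3 : (fun p : Fin 2 → ℝ => A.mulVec p i) = fun p => (LinearMap.toContinuousLinearMap (Matrix.mulVecLin A)) p i := rfl
    rw [h3, h2]
    simp
  have hint : ∀ i, Integrable fun p => A.mulVec p i • fderiv ℝ F p (Pi.single i 1) := fun i => by
    refine ((hg i).continuous.smul (hd.clm_apply continuous_const)).integrable_of_hasCompactSupport ?_
    refine hdc.mono fun p hp => ?_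
    rw [Function.mem_support] at hp ⊢
    exact fun h => hp (by simp [h])
  have hparts : ∀ i, ∫ p, A.mulVec p i • fderiv ℝ F p (Pi.single i 1) = -(A i i • ∫ p, F p) := fun i => by
    rw [integral_smul_fderiv_eq_neg_fderiv_smul_of_integrable _ (hint i) _
      (fun p _ => ((hg i).differentiable (by simp)).differentiableAt)
      (fun p _ => (hF.differentiable (by simp)).differentiableAt)]
    · simp only [hgd, integral_smul]
    · simp only [hgd]
      exact (hF.continuous.integrable_of_hasCompactSupport hc).smul _
    · exact ((hg i).continuous.smul hF.continuous).integrable_of_hasCompactSupport hc.smul_left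
  -- Integration by parts in each coordinate leaves `-A i i • ∫ F`, and these terms add up to the
  -- trace.
  have hsum : ∀ p, fderiv ℝ F p (A.mulVec p) = ∑ i, A.mulVec p i • fderiv ℝ F p (Pi.single i 1) := by
    intro p
    conv_lhs => rw [pi_eq_sum_univ' (A.mulVec p)]
    rw [map_sum]
    refine Finset.sum_congr rfl fun i _ => ?_
    rw [map_smul]
  simp only [hsum]
  rw [integral_finsetSum _ fun i _ => hint i]
  simp only [hparts]
  rw [Finset.sum_neg_distrib, ← Finset.sum_smul]
  change -(A.trace • _) = _
  rw [hA, zero_smul, neg_zero]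

/-! ### Equivariance of the power map -/

section PowerMap

variable {V : Type*} [NormedAddCommGroup V] [NormedSpace ℝ V] [LieRingModule sl2 V]
  [LieModule ℝ sl2 V] {n : ℕ} {v : V}

theorem contDiff_powerMap {m : WithTop ℕ∞} : ContDiff ℝ m (powerMap n v) := by
  unfold powerMap
  fun_prop

theorem fderiv_powerMap_apply (p w : Fin 2 → ℝ) : fderiv ℝ (powerMap n v) p w =
    ∑ j ∈ Finset.range (n + 1), ((((n - j : ℕ) : ℝ) * p 0 ^ (n - j - 1) * w 0 * p 1 ^ j +
      p 0 ^ (n - j) * (j * p 1 ^ (j - 1) * w 1)) / (j.factorial : ℝ)) •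
        ((LieModule.toEnd ℝ sl2 V Y) ^ j) v := by
  have h0 : HasFDerivAt (fun p : Fin 2 → ℝ => p 0)
      (ContinuousLinearMap.proj 0 : (Fin 2 → ℝ) →L[ℝ] ℝ) p := hasFDerivAt_apply 0 p
  have h1 : HasFDerivAt (fun p : Fin 2 → ℝ => p 1)
      (ContinuousLinearMap.proj 1 : (Fin 2 → ℝ) →L[ℝ] ℝ) p := hasFDerivAt_apply 1 p
  have hd := HasFDerivAt.fun_sum (u := Finset.range (n + 1)) fun j _ =>
    ((((h0.pow (n - j)).mul (h1.pow j)).mul_const ((j.factorial : ℝ)⁻¹)).smul_const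
      (((LieModule.toEnd ℝ sl2 V Y) ^ j) v))
  have he : powerMap n v = fun q => ∑ j ∈ Finset.range (n + 1),
      ((q 0 ^ (n - j) * q 1 ^ j) * ((j.factorial : ℝ)⁻¹)) • ((LieModule.toEnd ℝ sl2 V Y) ^ j) v := by
    ext q
    simp only [powerMap, div_eq_mul_inv]
  rw [he]
  refine (DFunLike.congr_fun (HasFDerivAt.fderiv hd) w).trans ?_
  rw [sum_apply]
  refine Finset.sum_congr rfl fun j _ => ?_
  rw [ContinuousLinearMap.smulRight_apply]
  congr 1
  simp
  ring

theorem fderiv_powerMap_Y [FiniteDimensional ℝ V]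
    (P : isSl2Triple.HasPrimitiveVectorWith v (n : ℝ)) (p : Fin 2 → ℝ) :
    fderiv ℝ (powerMap n v) p ![0, p 0] = ⁅Y, powerMap n v p⁆ := by
  rw [fderiv_powerMap_apply, powerMap, lie_sum, Finset.sum_range_succ', Finset.sum_range_succ]
  have hlast : ⁅Y, ((LieModule.toEnd ℝ sl2 V Y) ^ n) v⁆ = 0 := by
    rw [P.lie_f_pow_toEnd_f]
    exact P.pow_toEnd_f_eq_zero_of_eq_nat rfl
  rw [lie_smul, hlast, smul_zero]
  simp only [Matrix.cons_val_zero, Matrix.cons_val_one, Nat.cast_zero, mul_zero, zero_mul, add_zero,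
    zero_add, zero_div, zero_smul]
  refine Finset.sum_congr rfl fun j hj => ?_
  rw [Finset.mem_range] at hj
  rw [lie_smul, P.lie_f_pow_toEnd_f]
  congr 1
  rw [Nat.factorial_succ, show n - j = n - (j + 1) + 1 by omega]
  have : (j.factorial : ℝ) ≠ 0 := by positivity
  push_cast
  field_simp
  ring

theorem fderiv_powerMap_X (P : isSl2Triple.HasPrimitiveVectorWith v (n : ℝ)) (p : Fin 2 → ℝ) :
    fderiv ℝ (powerMap n v) p ![p 1, 0] = ⁅X, powerMap n v p⁆ := by
  rw [fderiv_powerMap_apply, powerMap, lie_sum, Finset.sum_range_succ, Finset.sum_range_succ']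
  have hfirst : ⁅X, ((LieModule.toEnd ℝ sl2 V Y) ^ 0) v⁆ = 0 := P.lie_e
  rw [lie_smul, hfirst, smul_zero]
  simp only [Matrix.cons_val_zero, Matrix.cons_val_one, Nat.cast_zero, mul_zero, zero_mul, add_zero,
    zero_div, zero_smul, Nat.sub_self]
  refine Finset.sum_congr rfl fun j hj => ?_
  rw [Finset.mem_range] at hj
  rw [lie_smul, P.lie_e_pow_succ_toEnd_f, smul_smul]
  congr 1
  rw [Nat.factorial_succ, Nat.cast_sub hj.le, Nat.sub_sub]
  have : (j.factorial : ℝ) ≠ 0 := by positivity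
  push_cast
  field_simp
  ring

theorem fderiv_powerMap_H (P : isSl2Triple.HasPrimitiveVectorWith v (n : ℝ)) (p : Fin 2 → ℝ) :
    fderiv ℝ (powerMap n v) p ![p 0, -p 1] = ⁅H, powerMap n v p⁆ := by
  rw [fderiv_powerMap_apply, powerMap, lie_sum]
  refine Finset.sum_congr rfl fun j hj => ?_
  rw [lie_smul, P.lie_h_pow_toEnd_f, smul_smul]
  congr 1
  rw [Finset.mem_range] at hj
  have h1 : ((n - j : ℕ) : ℝ) * p 0 ^ (n - j - 1) * p 0 = (n - j : ℝ) * p 0 ^ (n - j) := by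
    rw [← Nat.cast_sub (by omega)]
    rcases Nat.eq_zero_or_pos (n - j) with h | h
    · simp [h]
    · rw [mul_assoc, ← pow_succ, Nat.sub_add_cancel h]
  have h2 : (j : ℝ) * p 1 ^ (j - 1) * p 1 = j * p 1 ^ j := by
    rcases Nat.eq_zero_or_pos j with h | h
    · simp [h]
    · rw [mul_assoc, ← pow_succ, Nat.sub_add_cancel h]
  simp only [Matrix.cons_val_zero, Matrix.cons_val_one]
  rw [h1, mul_neg, h2]
  ring

/-- The map `powerMap n v` is equivariant. -/
theorem fderiv_powerMap [FiniteDimensional ℝ V]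
    (P : isSl2Triple.HasPrimitiveVectorWith v (n : ℝ)) (p : Fin 2 → ℝ) (Z : sl2) :
    fderiv ℝ (powerMap n v) p ((mat Z).mulVec p) = ⁅Z, powerMap n v p⁆ := by
  have hZ := trace_mat Z
  rw [Matrix.trace_fin_two] at hZ
  have hZ' : mat Z 1 1 = -mat Z 0 0 := by linarith
  have hw : (mat Z).mulVec p = mat Z 0 0 • ![p 0, -p 1] + mat Z 0 1 • ![p 1, 0] +
      mat Z 1 0 • ![0, p 0] := by
    ext i
    fin_cases i
    · simp [Matrix.mulVec, dotProduct, Fin.sum_univ_two]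
    · simp [Matrix.mulVec, dotProduct, Fin.sum_univ_two, hZ']
      ring
  rw [hw, map_add, map_add, map_smul, map_smul, map_smul, fderiv_powerMap_H P, fderiv_powerMap_X P,
    fderiv_powerMap_Y P]
  conv_rhs => rw [eq_combination Z]
  simp only [add_lie, smul_lie]

end PowerMap

/-! ### Construction and invariance of the generalized function of a section -/

section SectionDelta

variable {V : Type*} [NormedAddCommGroup V] [NormedSpace ℝ V] [LieRingModule sl2 V]
  [LieModule ℝ sl2 V] {n : ℕ} {v : V} {U : Opens sl2} {s : sl2 → Fin 2 → ℝ} {K : Compacts sl2}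

variable (n v s) in
/-- The pullback to `ℝ²` of the section `s_n`. -/
def sectionMap (p : Fin 2 → ℝ) : V := powerMap n v (s (moment p))

theorem IsSection.contDiffAt_sectionMap (hs : IsSection U s) {p : Fin 2 → ℝ} (hU : moment p ∈ U)
    {m : WithTop ℕ∞} : ContDiffAt ℝ m (sectionMap n v s) p := by
  obtain ⟨ε, -, hε⟩ := hs.eventually_eq hU
  have h1 : ContDiff ℝ m fun q : Fin 2 → ℝ => powerMap n v (ε • q) :=
    contDiff_powerMap.comp (contDiff_const_smul ε)
  exact h1.contDiffAt.congr_of_eventuallyEq (hε.mono fun q hq => by rw [sectionMap, hq])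

theorem IsSection.fderiv_sectionMap [FiniteDimensional ℝ V] (hs : IsSection U s)
    (P : isSl2Triple.HasPrimitiveVectorWith v (n : ℝ)) {p : Fin 2 → ℝ} (hU : moment p ∈ U)
    (Z : sl2) : fderiv ℝ (sectionMap n v s) p ((mat Z).mulVec p) = ⁅Z, sectionMap n v s p⁆ := by
  obtain ⟨ε, -, hε⟩ := hs.eventually_eq hU
  have h1 : sectionMap n v s =ᶠ[nhds p] fun q => powerMap n v (ε • q) :=
    hε.mono fun q hq => by rw [sectionMap, hq]
  rw [h1.fderiv_eq, h1.eq_of_nhds, ← fderiv_powerMap P, fderiv_comp_smul, smul_apply,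
    Matrix.mulVec_smul, map_smul]

theorem IsSection.contDiff_smul_sectionMap (hs : IsSection U s) (hK : (K : Set sl2) ⊆ U)
    (f : 𝓓_{K}(sl2, ℝ)) :
    ContDiff ℝ ((⊤ : ℕ∞) : WithTop ℕ∞) fun p => f (moment p) • sectionMap n v s p := by
  refine contDiff_iff_contDiffAt.mpr fun p => ?_
  by_cases hp : moment p ∈ K
  · exact (f.contDiff.comp contDiff_moment).contDiffAt.smul (hs.contDiffAt_sectionMap (hK hp))
  · have : (fun p => f (moment p) • sectionMap n v s p) =ᶠ[nhds p] fun _ => 0 := by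
      filter_upwards [(K.isCompact.isClosed.isOpen_compl.preimage continuous_moment).mem_nhds hp]
        with q hq
      rw [f.zero_on_compl hq]
      simp
    exact contDiffAt_const.congr_of_eventuallyEq this

variable (n v s) in
theorem hasCompactSupport_smul_sectionMap (f : 𝓓_{K}(sl2, ℝ)) :
    HasCompactSupport fun p => f (moment p) • sectionMap n v s p := by
  refine HasCompactSupport.intro (isCompact_preimage_moment K.isCompact) fun p hp => ?_
  rw [f.zero_on_compl hp]
  simp

theorem IsSection.integrable (hs : IsSection U s) (hK : (K : Set sl2) ⊆ U) (f : 𝓓_{K}(sl2, ℝ)) :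
    Integrable fun p => f (moment p) • sectionMap n v s p :=
  (hs.contDiff_smul_sectionMap hK f).continuous.integrable_of_hasCompactSupport
    (hasCompactSupport_smul_sectionMap n v s f)

/-- The generalized function `s_n δ_{𝒩⁺}` on test functions supported in `K`. -/
def IsSection.deltaOn (hs : IsSection U s) (hK : (K : Set sl2) ⊆ U) (n : ℕ) (v : V) :
    𝓓_{K}(sl2, ℝ) →ₗ[ℝ] V where
  toFun f := (2 : ℝ) • ∫ p, f (moment p) • sectionMap n v s p
  map_add' f g := by
    rw [← smul_add, ← integral_add (hs.integrable hK f) (hs.integrable hK g)]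
    simp only [← add_smul]
    rfl
  map_smul' c f := by
    rw [RingHom.id_apply, smul_comm c, ← integral_smul c]
    congr 2
    funext p
    exact smul_assoc c (f (moment p)) (sectionMap n v s p)

theorem IsSection.norm_deltaOn_le (hs : IsSection U s) (hK : (K : Set sl2) ⊆ U) (n : ℕ) (v : V)
    (f : 𝓓_{K}(sl2, ℝ)) : ‖hs.deltaOn hK n v f‖ ≤
      (2 * ∫ p in moment ⁻¹' K, ‖sectionMap n v s p‖) * ContDiffMapSupportedIn.seminorm ℝ sl2 ℝ ⊤ K 0 f := by
  have hc := isCompact_preimage_moment K.isCompact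
  have hi : IntegrableOn (fun p => ‖sectionMap n v s p‖) (moment ⁻¹' K) := by
    refine ContinuousOn.integrableOn_compact hc fun p hp => ?_
    exact ((hs.contDiffAt_sectionMap (m := 0) (hK hp)).continuousAt.norm).continuousWithinAt
  have h0 : ∫ p, f (moment p) • sectionMap n v s p =
      ∫ p in moment ⁻¹' K, f (moment p) • sectionMap n v s p := by
    rw [setIntegral_eq_integral_of_forall_compl_eq_zero]
    intro p hp
    rw [f.zero_on_compl hp]
    simp
  change ‖(2 : ℝ) • ∫ p, f (moment p) • sectionMap n v s p‖ ≤ _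
  rw [norm_smul, Real.norm_ofNat, h0, mul_assoc, mul_comm (∫ p in _, _), ← integral_const_mul]
  refine mul_le_mul_of_nonneg_left (norm_integral_le_of_norm_le (hi.const_mul _) ?_) two_pos.le
  refine .of_forall fun p => ?_
  rw [norm_smul]
  exact mul_le_mul_of_nonneg_right (ContDiffMapSupportedIn.norm_apply_le_seminorm ℝ) (norm_nonneg _)

/-- The generalized function `s_n δ_{𝒩⁺}`. -/
def IsSection.delta (hs : IsSection U s) (n : ℕ) (v : V) : 𝓓'(U, V) :=
  TestFunction.limitCLM ℝ (fun f => (2 : ℝ) • ∫ p, f (moment p) • sectionMap n v s p)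
    (fun K hK => ContDiffMapSupportedIn.mkCLMtoNormedSpace ℝ (hs.deltaOn hK n v)
      -- Only the seminorm of order `0` enters: `s_n δ` is a vector-valued measure.
      (map_add _) (map_smul _) ⟨{0}, _,
        mul_nonneg two_pos.le (integral_nonneg fun _ => norm_nonneg _), fun f => by
        rw [Finset.sup_singleton]
        exact hs.norm_deltaOn_le hK n v f⟩)
    (fun _ _ _ => rfl)

theorem IsSection.isSectionDelta (hs : IsSection U s) (n : ℕ) (v : V) :
    IsSectionDelta n v s (hs.delta n v) := fun _ => rfl

theorem IsSection.onCompact_delta (hs : IsSection U s) (hK : (K : Set sl2) ⊆ U) (n : ℕ) (v : V) :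
    onCompact hK (hs.delta n v) = hs.deltaOn hK n v := rfl

theorem IsSection.isIntertwining_deltaOn [FiniteDimensional ℝ V] (hs : IsSection U s)
    (hK : (K : Set sl2) ⊆ U) (P : isSl2Triple.HasPrimitiveVectorWith v (n : ℝ)) :
    IsIntertwining (hs.deltaOn hK n v) := by
  intro Z f
  have hF := hs.contDiff_smul_sectionMap (n := n) (v := v) hK f
  have h0 := integral_fderiv_mulVec_eq_zero (hF.of_le (by simp))
    (hasCompactSupport_smul_sectionMap n v s f) (trace_mat Z)
  -- The Leibniz rule and equivariance of both factors write the defect of intertwining as a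
  -- derivative along a traceless linear field, whose integral vanishes.
  have hd : ∀ p, fderiv ℝ (fun p => f (moment p) • sectionMap n v s p) p ((mat Z).mulVec p) =
      ⁅Z, f (moment p) • sectionMap n v s p⁆ - lieOp K Z f (moment p) • sectionMap n v s p := by
    intro p
    by_cases hp : moment p ∈ K
    · have h1 : DifferentiableAt ℝ (fun p => f (moment p)) p :=
        ((f.contDiff.comp contDiff_moment).differentiable (by simp)).differentiableAt
      have h2 : DifferentiableAt ℝ (sectionMap n v s) p :=
        (hs.contDiffAt_sectionMap (m := 1) (hK hp)).differentiableAt (by simp)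
      have h3 : fderiv ℝ (fun p => f (moment p)) p = (fderiv ℝ f (moment p)).comp (fderiv ℝ moment p) :=
        fderiv_comp p (f.contDiff.differentiable (by simp)).differentiableAt
          ((contDiff_moment (m := 1)).differentiable (by simp)).differentiableAt
      rw [fderiv_fun_smul h1 h2, add_apply, smul_apply, ContinuousLinearMap.smulRight_apply,
        hs.fderiv_sectionMap P (hK hp), h3, ContinuousLinearMap.comp_apply, fderiv_moment,
        lieOp_apply, map_neg, neg_smul, sub_neg_eq_add, lie_smul]
    · have : (fun p => f (moment p) • sectionMap n v s p) =ᶠ[nhds p] fun _ => 0 := by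
        filter_upwards [(K.isCompact.isClosed.isOpen_compl.preimage continuous_moment).mem_nhds hp]
          with q hq
        rw [f.zero_on_compl hq]
        simp
      rw [this.fderiv_eq, f.zero_on_compl hp, (lieOp K Z f).zero_on_compl hp]
      simp
  simp only [hd] at h0
  let A : V →L[ℝ] V := LinearMap.toContinuousLinearMap (LieModule.toEnd ℝ sl2 V Z)
  have hi := hs.integrable (n := n) (v := v) hK f
  have hi' := hs.integrable (n := n) (v := v) hK (lieOp K Z f)
  have hA : ∀ u, ⁅Z, u⁆ = A u := fun u => rfl
  simp only [hA] at h0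
  rw [integral_sub (A.integrable_comp hi) hi', sub_eq_zero] at h0
  change (2 : ℝ) • ∫ p, lieOp K Z f (moment p) • sectionMap n v s p = ⁅Z, (2 : ℝ) • ∫ p, f (moment p) • sectionMap n v s p⁆
  rw [← h0, lie_smul]
  congr 1
  exact A.integral_comp_comm hi

theorem IsSection.deltaOn_eq_zero (hs : IsSection U s) (hK : (K : Set sl2) ⊆ U)
    {f : 𝓓_{K}(sl2, ℝ)} (hf : ∀ P ∈ nilCone, f P = 0) : hs.deltaOn hK n v f = 0 := by
  change (2 : ℝ) • ∫ p, f (moment p) • sectionMap n v s p = 0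
  simp [hf _ (moment_mem_nilCone _)]

theorem IsSection.deltaOn_comp_coneOp (hs : IsSection U s) (hK : (K : Set sl2) ⊆ U) :
    hs.deltaOn hK n v ∘ₗ coneOp K = 0 := by
  ext f
  refine hs.deltaOn_eq_zero hK fun P hP => ?_
  have h1 : coneOp K f P = mat P 0 0 * (mat P 0 0 * f P) + mat P 0 1 * (mat P 1 0 * f P) := rfl
  rw [h1]
  linear_combination f P * (mem_nilCone_iff P).mp hP

theorem IsSection.isLocallyInvariant [FiniteDimensional ℝ V] (hs : IsSection U s)
    (P : isSl2Triple.HasPrimitiveVectorWith v (n : ℝ)) (i : ℕ) :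
    IsLocallyInvariant (casimir^[i] (hs.delta n v)) := by
  refine isLocallyInvariant_of_onCompact fun K hK => ?_
  rw [onCompact_casimir_iterate]
  exact (hs.isIntertwining_deltaOn hK P).box i

theorem IsSection.isSupportedInNilCone (hs : IsSection U s) (n : ℕ) (v : V) (i : ℕ) :
    IsSupportedInNilCone (casimir^[i] (hs.delta n v)) := by
  intro f hf
  rw [apply_eq_onCompact, onCompact_casimir_iterate]
  refine hs.deltaOn_eq_zero (supportCompact_subset f) fun P hP => ?_
  exact ContDiffMapSupportedIn.zero_on_compl _ fun hP' => (hf hP').2 hP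

end SectionDelta

/-! ### The Casimir equation -/

theorem moment_zero : moment 0 = 0 := by simp [moment_eq_combination]

/-- Away from the origin, a locally invariant generalized function which is supported in the cone
and vanishes where `x ≠ 0` is zero. -/
theorem IsLocallyInvariant.eq_zero_of_entry_ne_zero {U : Opens sl2} {E : Type*} [AddCommGroup E]
    [Module ℝ E] [TopologicalSpace E] [IsTopologicalAddGroup E] [ContinuousSMul ℝ E] [T2Space E]
    [FiniteDimensional ℝ E] [LieRingModule sl2 E] [LieModule ℝ sl2 E] {φ : 𝓓'(U, E)}
    (hinv : IsLocallyInvariant φ) (hsupp : IsSupportedInNilCone φ) (h0 : (0 : sl2) ∉ U)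
    (hx : ∀ (K : Compacts sl2) (hK : (K : Set sl2) ⊆ U), (∀ P ∈ K, mat P 0 1 ≠ 0) →
      onCompact hK φ = 0) : φ = 0 := by
  refine eq_zero_of_onCompact fun K hK => ?_
  obtain ⟨⟨M, hM⟩, L, hL⟩ := entry_torsion hsupp hx hK
  have w := weylRelations K
  obtain ⟨t, ht⟩ := isNilpotent_toEnd_X (V := E)
  have hi : IsIntertwining (onCompact hK φ) := onCompact_invariant hinv hK
  -- `L_X` takes `h` to `-y` and is nilpotent on `φ`, because `X` is nilpotent on `E`. This gives
  -- torsion in the last coordinate without any Casimir equation.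
  obtain ⟨J, hJ⟩ : ∃ J, onCompact hK φ ∘ₗ entryOp K 1 0 ^ J = 0 := by
    refine comp_pow_pow_eq_zero (P := lieOp K X) (h := entryOp K 0 0) (s := t) ?_ ?_ w.yh.symm ?_ hL
    · rw [lieOp_X, sub_mul, smul_mul_assoc, mul_assoc, w.rh, mul_assoc, w.ph, mul_sub, mul_smul_comm,
        mul_add, mul_one, ← mul_assoc (entryOp K 1 0), w.yh, mul_assoc (entryOp K 0 0) (entryOp K 1 0)]
      abel
    · rw [lieOp_X, sub_mul, mul_sub, smul_mul_assoc, mul_smul_comm, mul_assoc, w.ry, ← mul_assoc,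
        ← w.yh, mul_assoc, mul_assoc (entryOp K 1 0) (derivOp K H), w.py]
    · rw [hi.pow, ht, LinearMap.zero_comp]
  have hcomm : ∀ i j k l, Commute (entryOp K i j) (entryOp K k l) := fun _ _ _ _ => mulOp_comm _ _ _ _
  have hsq : ∀ {a : Module.End ℝ 𝓓_{K}(sl2, ℝ)} {N : ℕ}, onCompact hK φ ∘ₗ a ^ N = 0 →
      onCompact hK φ ∘ₗ (a ^ 2) ^ N = 0 := fun {a N} h => by
    rw [← pow_mul, two_mul, pow_add]
    exact comp_mul_eq_zero h _
  -- A power of `h² + x² + y²` kills `φ`; this function is invertible on `K` because `0 ∉ U`.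
  have hsum := comp_add_pow_eq_zero (.add_left ((hcomm 0 0 1 0).pow_pow 2 2)
    ((hcomm 0 1 1 0).pow_pow 2 2)) (comp_add_pow_eq_zero ((hcomm 0 0 0 1).pow_pow 2 2)
    (hsq hL) (hsq hM)) (hsq hJ)
  have hg : ContDiff ℝ ((⊤ : ℕ∞) : WithTop ℕ∞) fun P : sl2 =>
    entry 0 0 P ^ 2 + entry 0 1 P ^ 2 + entry 1 0 P ^ 2 := by fun_prop
  have hg0 : ∀ P ∈ K, entry 0 0 P ^ 2 + entry 0 1 P ^ 2 + entry 1 0 P ^ 2 ≠ 0 := by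
    intro P hP h
    apply h0
    have h00 : mat P 0 0 = 0 := by
      rw [← entry_apply]
      nlinarith [sq_nonneg (entry 0 0 P), sq_nonneg (entry 0 1 P), sq_nonneg (entry 1 0 P)]
    have h01 : mat P 0 1 = 0 := by
      rw [← entry_apply]
      nlinarith [sq_nonneg (entry 0 0 P), sq_nonneg (entry 0 1 P), sq_nonneg (entry 1 0 P)]
    have h10 : mat P 1 0 = 0 := by
      rw [← entry_apply]
      nlinarith [sq_nonneg (entry 0 0 P), sq_nonneg (entry 0 1 P), sq_nonneg (entry 1 0 P)]
    have : P = 0 := by rw [eq_combination P, h00, h01, h10]; simp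
    exact this ▸ hK hP
  have hw : entryOp K 0 0 ^ 2 + entryOp K 0 1 ^ 2 + entryOp K 1 0 ^ 2 =
      mulOp K _ fun _ _ => hg.contDiffAt := by
    ext f P
    rw [mulOp_apply, add_mul, add_mul, ← mulOp_pow, ← mulOp_pow, ← mulOp_pow]
    rfl
  have hone : mulOp K _ (fun _ _ => hg.contDiffAt) *
      mulOp K _ (fun P hP => hg.contDiffAt.inv (hg0 P hP)) = 1 := by
    ext f P
    change (entry 0 0 P ^ 2 + entry 0 1 P ^ 2 + entry 1 0 P ^ 2) *
      ((entry 0 0 P ^ 2 + entry 0 1 P ^ 2 + entry 1 0 P ^ 2)⁻¹ * f P) = f P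
    by_cases hP : P ∈ K
    · rw [← mul_assoc, mul_inv_cancel₀ (hg0 P hP), one_mul]
    · have : f P = 0 := f.zero_on_compl hP
      simp [this]
  rw [hw] at hsum
  have h1 := comp_mul_eq_zero hsum (mulOp K _ (fun P hP => hg.contDiffAt.inv (hg0 P hP)) ^ (L + M + J))
  rwa [← Commute.mul_pow (mulOp_comm _ _ _ _), hone, one_pow, comp_one] at h1

/-! ### Powers of the Casimir operator on the generalized function of a section -/

section SectionDelta

variable {V : Type*} [NormedAddCommGroup V] [NormedSpace ℝ V] [FiniteDimensional ℝ V]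
  [LieRingModule sl2 V] [LieModule ℝ sl2 V] {n : ℕ} {v : V} {U : Opens sl2} {s : sl2 → Fin 2 → ℝ}

theorem IsSection.casimir_iterate_eq_zero (hs : IsSection U s) (hV : Module.finrank ℝ V = n + 1)
    (P : isSl2Triple.HasPrimitiveVectorWith v (n : ℝ)) (hn : Odd n) {k : ℕ} (hk : (n + 1) / 2 ≤ k) :
    casimir^[k] (hs.delta n v) = 0 := by
  obtain ⟨m, hm⟩ := hn
  have hnm : (n : ℝ) = 2 * ((m + 1 : ℕ) : ℝ) - 1 := by
    rw [hm]
    push_cast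
    ring
  -- With `n = 2 m + 1` the power `m + 1` of the radial operator starts with `q ^ (m + 1)` on the
  -- left, and a single `q` already kills `s_n δ`.
  have hbase : casimir^[m + 1] (hs.delta n v) = 0 := by
    refine (hs.isLocallyInvariant P _).eq_zero_of_entry_ne_zero (hs.isSupportedInNilCone n v _)
      (moment_zero ▸ hs.zero_notMem) fun K hK hx => ?_
    have hψ := hs.isIntertwining_deltaOn hK P
    have hΛ := isLowestMap_coord hV P
    rw [onCompact_casimir_iterate]
    refine (hψ.box (m + 1)).eq_zero hΛ ?_
    obtain ⟨B, hB⟩ := radial_pow_self (transversalOp_mul_coneOp hx) (m + 1)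
    rw [← LinearMap.comp_assoc, hψ.comp_box_pow hΛ hx, hnm, hB, pow_succ',
      mul_assoc]
    exact comp_mul_eq_zero (by rw [LinearMap.comp_assoc, hs.deltaOn_comp_coneOp, LinearMap.comp_zero]) _
  obtain ⟨j, rfl⟩ := Nat.exists_eq_add_of_le (show m + 1 ≤ k by omega)
  refine eq_zero_of_onCompact fun K hK => ?_
  have h1 := onCompact_casimir_iterate hK (hs.delta n v) (m + 1)
  rw [hbase, onCompact_zero] at h1
  rw [onCompact_casimir_iterate, pow_add]
  exact comp_mul_eq_zero h1.symm _

theorem coord_zero_powerMap (hV : Module.finrank ℝ V = n + 1)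
    (P : isSl2Triple.HasPrimitiveVectorWith v (n : ℝ)) (p : Fin 2 → ℝ) :
    (weightBasis hV P).coord 0 (powerMap n v p) = p 0 ^ n := by
  rw [powerMap, Finset.sum_range, map_sum, Finset.sum_eq_single 0]
  · rw [← weightBasis_apply hV P, map_smul, Module.Basis.coord_apply, Module.Basis.repr_self]
    simp
  · intro j _ hj
    rw [← weightBasis_apply hV P, map_smul, Module.Basis.coord_apply, Module.Basis.repr_self]
    simp [hj]
  · simp

/-- Near `X`, the first coordinate of a section has constant sign. -/
theorem IsSection.exists_closedBall (hs : IsSection U s) (hX : X ∈ U) : ∃ δ > 0,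
    Metric.closedBall X δ ⊆ U ∧ (∀ Z ∈ Metric.closedBall X δ, mat Z 0 1 ≠ 0) ∧
      ∀ Z ∈ Metric.closedBall X δ, Z ∈ nilConePos → 0 < s Z 0 * s X 0 := by
  have hXm : moment ![√2, 0] = X := by
    rw [moment_eq_combination]
    simp
  have hXpos : X ∈ nilConePos := by
    rw [← hXm]
    exact moment_mem_nilConePos fun h => by simpa using congrFun h 0
  have hc : ContinuousWithinAt (fun Z => s Z 0 * s X 0) ((U : Set sl2) ∩ nilConePos) X :=
    ((continuous_apply 0).continuousAt.comp_continuousWithinAt (hs.1 X ⟨hX, hXpos⟩)).mul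
      continuousWithinAt_const
  have h0 : 0 < s X 0 * s X 0 := by
    have h1 : mat (moment (s X)) 0 1 = mat X 0 1 := by rw [hs.2 X ⟨hX, hXpos⟩]
    rw [mat_moment_zero_one, X, mat_ofCoords] at h1
    have h2 : s X 0 ^ 2 / 2 = 1 := h1
    nlinarith
  have h1 := eventually_nhdsWithin_iff.mp (hc.eventually (lt_mem_nhds h0))
  have h2 : ∀ᶠ Z in nhds X, mat Z 0 1 ≠ 0 := (entry 0 1).continuous.continuousAt.eventually_ne (by
    simp [entry_apply, X, mat_ofCoords])
  obtain ⟨δ, hδ, h⟩ := Metric.nhds_basis_closedBall.eventually_iff.mp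
    ((h1.and h2).and (U.isOpen.mem_nhds hX))
  exact ⟨δ, hδ, fun Z hZ => (h hZ).2, fun Z hZ => (h hZ).1.2, fun Z hZ hZ' =>
    (h hZ).1.1 ⟨(h hZ).2, hZ'⟩⟩

/-- On the highest weight coefficient, `□ ^ i` followed by `q ^ i` gives back a nonzero multiple of
`s_n δ`. That coefficient is the density `a ^ n`, which has constant sign near `X`. -/
theorem IsSection.casimir_iterate_ne_zero (hs : IsSection U s) (hX : X ∈ U)
    (hV : Module.finrank ℝ V = n + 1) (P : isSl2Triple.HasPrimitiveVectorWith v (n : ℝ)) {i : ℕ}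
    (hi : i ≤ (n - 1) / 2) : casimir^[i] (hs.delta n v) ≠ 0 := by
  intro hzero
  obtain ⟨δ, hδ, hball, hx, hpos⟩ := hs.exists_closedBall hX
  let K : Compacts sl2 := ⟨Metric.closedBall X δ, isCompact_closedBall X δ⟩
  have hK : (K : Set sl2) ⊆ U := hball
  have hxK : ∀ P ∈ K, mat P 0 1 ≠ 0 := hx
  have hψ := hs.isIntertwining_deltaOn hK P
  have hΛ := isLowestMap_coord hV P
  have hu : (weightBasis hV P).coord 0 ∘ₗ hs.deltaOn hK n v = 0 := by
    have h1 := onCompact_casimir_iterate hK (hs.delta n v) i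
    rw [hzero, onCompact_zero, hs.onCompact_delta] at h1
    have h2 := hψ.comp_box_pow hΛ hxK i
    rw [LinearMap.comp_assoc, ← h1, LinearMap.comp_zero] at h2
    obtain ⟨B, hB⟩ := radial_pow_mul_pow (transversalOp_mul_coneOp hxK) (n : ℝ) 1 i le_rfl
    have h3 := comp_mul_eq_zero h2.symm (coneOp K ^ (1 - 1 + i))
    have h4 : ((weightBasis hV P).coord 0 ∘ₗ hs.deltaOn hK n v) ∘ₗ coneOp K = 0 := by
      rw [LinearMap.comp_assoc, hs.deltaOn_comp_coneOp, LinearMap.comp_zero]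
    rw [hB, LinearMap.comp_add, pow_one, comp_mul_eq_zero h4, add_zero, LinearMap.comp_smul,
      Nat.sub_self, pow_zero, comp_one] at h3
    refine (smul_eq_zero.mp h3).resolve_left (Finset.prod_ne_zero_iff.mpr fun j hj => ?_)
    rw [Finset.mem_range] at hj
    -- The indicial values at `1, …, i` are nonzero since all these integers lie below the root `(n
    -- + 1) / 2`.
    have hjn : (2 * (j + 1) : ℝ) < n + 1 := by
      exact_mod_cast (by omega : 2 * (j + 1) < n + 1)
    refine mul_ne_zero (by positivity) (ne_of_lt ?_)
    push_cast
    linarith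
  let b : ContDiffBump X := ⟨δ / 2, δ, half_pos hδ, half_lt_self hδ⟩
  let f : 𝓓_{K}(sl2, ℝ) := .of_support_subset b.contDiff (by
    rw [b.support_eq]
    exact Metric.ball_subset_closedBall)
  have hf : ∀ Z, f Z = b Z := fun _ => rfl
  have hi := hs.integrable (n := n) (v := v) hK f
  let A : V →L[ℝ] ℝ := LinearMap.toContinuousLinearMap ((weightBasis hV P).coord 0)
  have hA : ∀ p, A (sectionMap n v s p) = s (moment p) 0 ^ n := fun p => coord_zero_powerMap hV P _
  have h5 : A ((2 : ℝ) • ∫ p, f (moment p) • sectionMap n v s p) = 0 := LinearMap.congr_fun hu f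
  rw [map_smul, ← A.integral_comp_comm hi] at h5
  -- The constant factor `s X 0 ^ n` makes the integrand nonnegative, whichever sign the section has
  -- at `X`.
  have h6 : ∫ p, A (f (moment p) • sectionMap n v s p) * s X 0 ^ n = 0 := by
    rw [integral_mul_const, (smul_eq_zero.mp h5).resolve_left two_ne_zero, zero_mul]
  have h7 : ∀ p, A (f (moment p) • sectionMap n v s p) * s X 0 ^ n =
      f (moment p) * (s (moment p) 0 * s X 0) ^ n := fun p => by
    rw [map_smul, hA, smul_eq_mul, mul_pow, mul_assoc]
  have hsign : ∀ p, moment p ∈ K → 0 < (s (moment p) 0 * s X 0) ^ n := fun p hp =>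
    pow_pos (hpos _ hp (moment_mem_nilConePos (hs.ne_zero (hK hp)))) n
  refine (Continuous.integral_pos_of_hasCompactSupport_nonneg_nonzero (μ := volume)
    (x := (![√2, 0] : Fin 2 → ℝ)) ?_ ?_ ?_ ?_).ne' h6
  · exact (A.continuous.comp (hs.contDiff_smul_sectionMap hK f).continuous).mul continuous_const
  · exact ((hasCompactSupport_smul_sectionMap n v s f).comp_left (map_zero A)).mul_right
  · intro p
    change 0 ≤ A (f (moment p) • sectionMap n v s p) * s X 0 ^ n
    rw [h7]
    by_cases hp : moment p ∈ K
    · exact mul_nonneg b.nonneg (hsign p hp).le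
    · rw [f.zero_on_compl hp]
      simp
  · have hXm : moment ![√2, 0] = X := by
      rw [moment_eq_combination]
      simp
    rw [h7, hXm, hf, b.one_of_mem_closedBall (Metric.mem_closedBall_self b.rIn_pos.le), one_mul]
    have h8 := hsign ![√2, 0] (hXm ▸ Metric.mem_closedBall_self hδ.le)
    rw [hXm] at h8
    exact h8.ne'

end SectionDelta

/-! ### Existence of sections -/

theorem exists_isSection (O : Opens sl2) (hO : X ∈ O) :
    ∃ U : Opens sl2, U ≤ O ∧ X ∈ U ∧ IsConnected (U : Set sl2) ∧
      ∃ s : sl2 → Fin 2 → ℝ, IsSection U s := by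
  have h1 : ∀ᶠ Z in nhds X, 0 < mat Z 0 1 := (entry 0 1).continuous.continuousAt.eventually
    (lt_mem_nhds (by simp [entry_apply, X, mat_ofCoords]))
  obtain ⟨δ, hδ, h⟩ := Metric.nhds_basis_ball.eventually_iff.mp (h1.and (O.isOpen.mem_nhds hO))
  refine ⟨⟨Metric.ball X δ, Metric.isOpen_ball⟩, fun Z hZ => (h hZ).2, Metric.mem_ball_self hδ,
    (convex_ball X δ).isConnected ⟨X, Metric.mem_ball_self hδ⟩,
    -- Solve `x = a² / 2` with `a > 0`, then `h = -a b / 2` for `b`; the equation for `y` follows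
    -- from `h² + xy = 0`.
    fun Z => ![√(2 * mat Z 0 1), -2 * mat Z 0 0 / √(2 * mat Z 0 1)], ?_, ?_⟩
  · rintro Z ⟨hZ, -⟩
    have hx : 0 < mat Z 0 1 := (h hZ).1
    have hsq : ContinuousAt (fun Z => √(2 * mat Z 0 1)) Z :=
      ((entry 0 1).continuous.const_mul 2).sqrt.continuousAt
    have hh : ContinuousAt (fun Z => -2 * mat Z 0 0) Z :=
      ((entry 0 0).continuous.const_mul (-2)).continuousAt
    refine ContinuousAt.continuousWithinAt (continuousAt_pi.mpr fun i => ?_)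
    fin_cases i
    · exact hsq
    · exact hh.div hsq (by positivity)
  · rintro Z ⟨hZ, hZ', -⟩
    have hx : 0 < mat Z 0 1 := (h hZ).1
    have hq : 0 < √(2 * mat Z 0 1) := by positivity
    have hqq : √(2 * mat Z 0 1) ^ 2 = 2 * mat Z 0 1 := Real.sq_sqrt (by positivity)
    rw [mem_nilCone_iff] at hZ'
    rw [moment_eq_combination]
    conv_rhs => rw [eq_combination Z]
    simp only [Matrix.cons_val_zero, Matrix.cons_val_one]
    congr 2
    · congr 2
      field_simp
    · rw [hqq]
      congr 1
      ring
    · rw [div_pow, hqq]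
      field_simp
      linear_combination -hZ'

end SL2Dist

end

/-! ### The main theorem -/

theorem mainTheorem5 (n : ℕ)
    {V : Type*} [NormedAddCommGroup V] [NormedSpace ℝ V] [FiniteDimensional ℝ V]
    [LieRingModule SL2Dist.sl2 V] [LieModule ℝ SL2Dist.sl2 V]
    [LieModule.IsIrreducible ℝ SL2Dist.sl2 V] (hV : Module.finrank ℝ V = n + 1)
    {W : Type*} [AddCommGroup W] [Module ℝ W] [FiniteDimensional ℝ W]
    [LieRingModule SL2Dist.sl2 W] [LieModule ℝ SL2Dist.sl2 W] [LieModule.IsTrivial SL2Dist.sl2 W]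
    [TopologicalSpace (W ⊗[ℝ] V)] [IsTopologicalAddGroup (W ⊗[ℝ] V)]
    [ContinuousSMul ℝ (W ⊗[ℝ] V)] [T2Space (W ⊗[ℝ] V)] :
    -- the vanishing theorem
    (∀ U : Opens SL2Dist.sl2, SL2Dist.X ∈ U → IsConnected (U : Set SL2Dist.sl2) →
      ∀ φ : 𝓓'(U, W ⊗[ℝ] V),
        SL2Dist.IsLocallyInvariant φ → SL2Dist.IsSupportedInNilCone φ →
        ∀ (r : ℕ) (a : Fin r → ℝ),
          SL2Dist.casimir^[r] φ + ∑ k : Fin r, a k • SL2Dist.casimir^[(k : ℕ)] φ = 0 →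
          (Even n ∨ (Odd n ∧ ∃ hr : 0 < r, a ⟨0, hr⟩ ≠ 0)) →
          φ = 0) ∧
    -- for odd `n`, the nonzero solutions of the equation `□ ^ k φ = 0`
    (Odd n →
      ∀ v : V, v ≠ 0 → ⁅SL2Dist.X, v⁆ = 0 →
      ∀ U : Opens SL2Dist.sl2, SL2Dist.X ∈ U → IsConnected (U : Set SL2Dist.sl2) →
      ∀ s : SL2Dist.sl2 → Fin 2 → ℝ, SL2Dist.IsSection U s →
        ∃ φ₀ : 𝓓'(U, V), SL2Dist.IsSectionDelta n v s φ₀ ∧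
          ∀ i : ℕ, i ≤ (n - 1) / 2 →
            SL2Dist.casimir^[i] φ₀ ≠ 0 ∧
            SL2Dist.IsLocallyInvariant (SL2Dist.casimir^[i] φ₀) ∧
            SL2Dist.IsSupportedInNilCone (SL2Dist.casimir^[i] φ₀) ∧
            ∀ k : ℕ, (n + 1) / 2 ≤ k →
              SL2Dist.casimir^[k] (SL2Dist.casimir^[i] φ₀) = 0) ∧
    -- every neighborhood of `X` contains a connected open one on which a section exists
    (∀ O : Opens SL2Dist.sl2, SL2Dist.X ∈ O →
      ∃ U : Opens SL2Dist.sl2, U ≤ O ∧ SL2Dist.X ∈ U ∧ IsConnected (U : Set SL2Dist.sl2) ∧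
        ∃ s : SL2Dist.sl2 → Fin 2 → ℝ, SL2Dist.IsSection U s) := by
  refine ⟨fun U _ _ φ hinv hsupp r a ha hn => ?_, fun hn v hv hXv U hX _ s hs => ?_,
    SL2Dist.exists_isSection⟩
  · obtain ⟨v, P⟩ := SL2Dist.exists_primitive_of_finrank hV
    exact SL2Dist.vanishing_of_monic (SL2Dist.isLowestMap_tensor W hV P) hinv hsupp a ha hn
  · have P := SL2Dist.primitive_of_lie_X hV hv hXv
    refine ⟨hs.delta n v, hs.isSectionDelta n v, fun i hi => ⟨hs.casimir_iterate_ne_zero hX hV P hi,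
      hs.isLocallyInvariant P i, hs.isSupportedInNilCone n v i, fun k hk => ?_⟩⟩
    rw [← Function.iterate_add_apply]
    exact hs.casimir_iterate_eq_zero hV P hn (hk.trans (Nat.le_add_right k i))
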